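/- Let $V \subset V'$ be an immediate extension of valuation rings with fraction field extension $K \subset K'$, i.e. the inclusion $V \subset V'$ is a local homomorphism inducing isomorphisms between the value groups and between the residue fields of $V$ and $V'$; the field extension $K \subset K'$ is arbitrary. Then $V'$ is a filtered union of its complete intersection $V$-subalgebras, that is, there is a nonempty upward directed family of $V$-subalgebras of $V'$ with union $V'$, each of which is a complete intersection $V$-algebra. Here a complete intersection $V$-algebra is a $V$-algebra isomorphic to $T_h/(P)$, where $T = V[X_1,\dots,X_n]$ is a polynomial $V$-algebra in finitely many variables, $0 \neq h \in T$, and $P$ is a finite regular sequence of elements of $T_h$. -/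

import Mathlib

/-- An extension `V → V'` of valuation rings, with fraction field extension `K → K'`, is
*immediate* if it is local and induces isomorphisms between the residue fields and between the
value groups of `V` and `V'`.  (The map `V → V'` is automatically injective, since `K → K'` is.
`ValuationRing.ValueGroup` is the value group with a zero element adjoined, written
multiplicatively; the condition in `valueGroup` says that the ordered isomorphism is the one
induced by `K → K'`.) -/
structure IsImmediateExtension (V V' K K' : Type*)
    [CommRing V] [IsDomain V] [ValuationRing V]
    [CommRing V'] [IsDomain V'] [ValuationRing V']
    [Field K] [Algebra V K] [IsFractionRing V K]
    [Field K'] [Algebra V' K'] [IsFractionRing V' K']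
    [Algebra V V'] [Algebra K K'] : Prop where
  isLocalHom : IsLocalHom (algebraMap V V')
  residueField : Function.Bijective (IsLocalRing.ResidueField.map (algebraMap V V'))
  valueGroup : ∃ e : ValuationRing.ValueGroup V K ≃*o ValuationRing.ValueGroup V' K',
    ∀ x : K, e (ValuationRing.valuation V K x) =
      ValuationRing.valuation V' K' (algebraMap K K' x)

/-- A *complete intersection* `A`-algebra: an `A`-algebra isomorphic to `T_h / (P)`, where
`T = A[X₁, …, Xₙ]` is a polynomial algebra in finitely many variables, `0 ≠ h ∈ T`, and `P` is a
finite regular sequence in `T_h`.  No flatness over `A` is required. -/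
def IsCompleteIntersectionAlgebra (A B : Type*) [CommRing A] [CommRing B] [Algebra A B] : Prop :=
  ∃ (n : ℕ) (h : MvPolynomial (Fin n) A) (P : List (Localization.Away h)),
    h ≠ 0 ∧
    RingTheory.Sequence.IsRegular (Localization.Away h) P ∧
    Nonempty (B ≃ₐ[A] (Localization.Away h ⧸ Ideal.ofList P))

/-- `B` is a *filtered union* of `A`-subalgebras satisfying `Q`: there is a nonempty upward
directed family of `A`-subalgebras of `B`, all satisfying `Q`, whose union is `B`. -/
def IsFilteredUnionOfSubalgebras (A B : Type*) [CommRing A] [CommRing B] [Algebra A B]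
    (Q : Subalgebra A B → Prop) : Prop :=
  ∃ F : Set (Subalgebra A B), F.Nonempty ∧ DirectedOn (· ≤ ·) F ∧
    (∀ C ∈ F, Q C) ∧ ∀ b : B, ∃ C ∈ F, b ∈ C

-- Let `v` be the valuation of `V'`, `m` the maximal ideal of `V`. It is enough to put every finite
-- subset of `V'` into one complete intersection subalgebra: these subalgebras are finitely
-- generated over `V`, so the family of all of them is then directed.
--
-- Such a subalgebra comes from a presentation (`IsPresentation`): a map from a polynomial ring `T`
-- over `V` to `K'` with values in `V'`, and a list `j` in its kernel that is regular on the closed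
-- fibre `T/mT` at the centre `q` of `v`, and that generates the kernel up to factors `c * s` with
-- `0 ≠ c ∈ V` and `s ∉ q`. After descent to a Noetherian local subring of `V`, the local criterion
-- of flatness shows that `j` is regular in `T_q` and that `T_q/(j)` has no `V`-torsion, so `j`
-- generates the kernel at `q`. By Nagata's theorem (`MvPolynomial.fg_of_saturated`) ideals with
-- torsion-free quotient are finitely generated. Hence both properties spread from `T_q` to a single
-- `T_h` (`exists_completeIntersection_subalgebra`).
--
-- Presentations are built by adjoining the elements of the finite set to `K` one at a time. To pass
-- from `L` to `L(x)`, integral elements are written as fractions of polynomials in `x` of degree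
-- less than `N`, where `N` is the degree of `x` over `L` if `x` is algebraic. Since `K` attains all
-- values, polynomials can be scaled by constants of `K` to have value one at `x`. Let the level `s`
-- be the ring generated by the polynomials of degree less than `s` that are integral at `x`. When
-- level `q + 1` is larger than level `q`, finitely many of its elements are polynomials over level
-- `q` in a single `z = ψ / e`, with `ψ` monic of degree `q` and `ψ(x)` of small enough value
-- (`exists_normal_form`); these `ψ` play the role of key polynomials.
--
-- Expanding one such `ψ` in powers of the previous normalized polynomial `z'` gives a relation
-- `P(z') = d z`, where `P` has a coefficient of value one and `d ∈ m` because `z` is not in the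
-- lower level. Modulo `m` the relation is `P(z')`: it has a unit coefficient, and `z'` occurs in no
-- earlier relation modulo `m`, so it is regular by McCoy's theorem. The new variable `z` disappears
-- modulo `m`, so the process continues (`IsStage.next`). If `x` is algebraic, expanding its minimal
-- polynomial in the same way gives one last regular relation.

universe u

/-! ### Regular sequences, colon ideals and the local criterion of flatness -/

/-- `f` is a nonzerodivisor modulo `b` after inverting `S`. -/
def RegularAt {T : Type*} [CommRing T] (S : Submonoid T) (b : Ideal T) (f : T) : Prop :=
  ∀ y, f * y ∈ b → ∃ s ∈ S, s * y ∈ b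

/-- The list is a weakly regular sequence modulo `b` after inverting `S`. -/
def RegularSeqAt {T : Type*} [CommRing T] (S : Submonoid T) : Ideal T → List T → Prop
  | _, [] => True
  | b, f :: l => RegularAt S b f ∧ RegularSeqAt S (b ⊔ Ideal.span {f}) l

/-- The ideal quotient `(b : y)` by an element. -/
def Ideal.colonElem {R : Type*} [CommRing R] (b : Ideal R) (y : R) : Ideal R :=
  Submodule.comap (LinearMap.mulLeft R y) b

theorem Ideal.mem_colonElem {R : Type*} [CommRing R] {b : Ideal R} {y r : R} :
    r ∈ b.colonElem y ↔ y * r ∈ b := Iff.rfl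

/-- Equational criterion of flatness: membership of `y s` in the extended ideal is a linear relation
over `R`. Its triviality writes `s` as a combination of elements `a` of `R` with `y a ∈ b`. -/
theorem Ideal.mem_map_colonElem_of_flat {R R' : Type*} [CommRing R] [CommRing R'] [Algebra R R']
    [Module.Flat R R'] (b : Ideal R) (y : R) (s : R')
    (h : algebraMap R R' y * s ∈ b.map (algebraMap R R')) :
    s ∈ (b.colonElem y).map (algebraMap R R') := by
  obtain ⟨n, c, g, hg⟩ := Submodule.mem_span_set'.1 h
  choose r hr hr' using fun i => (g i).2
  let f : Option (Fin n) → R := fun o => o.elim y (fun i => - r i)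
  let x : Option (Fin n) → R' := fun o => o.elim s c
  have hrel : ∑ i, f i • x i = 0 := by
    rw [Fintype.sum_option]
    simp only [f, x, Option.elim_none, Option.elim_some, Algebra.smul_def, ← hg, map_neg, hr',
      neg_mul, Finset.sum_neg_distrib]
    rw [← sub_eq_add_neg, sub_eq_zero]
    exact Finset.sum_congr rfl fun i _ => mul_comm _ _
  obtain ⟨k, a, z, hz, ha⟩ :=
    Module.Flat.isTrivialRelation_of_sum_smul_eq_zero (R := R) (M := R') (f := f) (x := x) hrel
  have hs := hz none
  simp only [x, Option.elim_none] at hs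
  rw [hs]
  refine Ideal.sum_mem _ fun j _ => ?_
  rw [Algebra.smul_def]
  refine Ideal.mul_mem_right _ _ (Ideal.mem_map_of_mem _ ?_)
  rw [Ideal.mem_colonElem]
  have := ha j
  rw [Fintype.sum_option] at this
  simp only [f, Option.elim_none, Option.elim_some] at this
  rw [eq_neg_of_add_eq_zero_left this]
  exact b.neg_mem (Ideal.sum_mem _ fun i _ => Ideal.mul_mem_right _ _ (b.neg_mem (hr i)))

/-- Ideal-theoretic form of flatness over `A` of the quotient `O ⧸ J`. -/
def ColonFlat (A : Type*) {O : Type*} [CommRing A] [CommRing O] [Algebra A O] (J : Ideal O) : Prop :=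
  ∀ (a : Ideal A) (t : A) (x : O), algebraMap A O t * x ∈ a.map (algebraMap A O) ⊔ J →
    x ∈ (a.colonElem t).map (algebraMap A O) ⊔ J

theorem Ideal.mem_sup_span_singleton_iff {R : Type*} [CommRing R] {I : Ideal R} {x y : R} :
    x ∈ I ⊔ Ideal.span {y} ↔ ∃ z, x - y * z ∈ I := by
  rw [Submodule.mem_sup]
  constructor
  · rintro ⟨a, ha, b, hb, rfl⟩
    obtain ⟨z, rfl⟩ := Ideal.mem_span_singleton'.1 hb
    exact ⟨z, by simpa [mul_comm] using ha⟩
  · rintro ⟨z, hz⟩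
    exact ⟨_, hz, y * z, Ideal.mem_span_singleton'.2 ⟨z, mul_comm _ _⟩, by ring⟩

theorem ColonFlat.bot_of_flat {A O : Type*} [CommRing A] [CommRing O] [Algebra A O] [Module.Flat A O] : ColonFlat A (⊥ : Ideal O) := by
  intro a t x hx
  rw [sup_bot_eq] at hx ⊢
  exact Ideal.mem_map_colonElem_of_flat a t x hx

/-- If `t x ≡ f y` modulo `aO + J`, regularity of `f` for the ideal `a + (t)` gives `y ≡ t z`, so `t
(x - f z)` lies in `aO + J` and flatness of `O/J` applies to `x - f z`. -/
theorem ColonFlat.sup_span_singleton {A O : Type*} [CommRing A] [CommRing O] [Algebra A O]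
    {J : Ideal O} {f : O} (hFl : ColonFlat A J)
    (hreg : ∀ (a : Ideal A) (x), f * x ∈ a.map (algebraMap A O) ⊔ J →
      x ∈ a.map (algebraMap A O) ⊔ J) : ColonFlat A (J ⊔ Ideal.span {f}) := by
  intro a t x hx
  rw [← sup_assoc, Ideal.mem_sup_span_singleton_iff] at hx
  obtain ⟨y, hy⟩ := hx
  have hmap : (a ⊔ Ideal.span {t}).map (algebraMap A O) ⊔ J =
      (a.map (algebraMap A O) ⊔ J) ⊔ Ideal.span {algebraMap A O t} := by
    rw [Ideal.map_sup, Ideal.map_span, Set.image_singleton]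
    ac_rfl
  have h1 : f * y ∈ (a ⊔ Ideal.span {t}).map (algebraMap A O) ⊔ J := by
    rw [hmap, Ideal.mem_sup_span_singleton_iff]
    exact ⟨x, by simpa using neg_mem hy⟩
  have h2 := hreg _ _ h1
  rw [hmap, Ideal.mem_sup_span_singleton_iff] at h2
  obtain ⟨z, hz⟩ := h2
  have h3 := hFl a t (x - f * z) (by
    have := Ideal.add_mem _ hy (Ideal.mul_mem_left _ f hz)
    convert this using 1
    ring)
  rw [← sup_assoc, Ideal.mem_sup_span_singleton_iff]
  exact ⟨z, h3⟩

section LocalFlat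

variable {A O : Type*} [CommRing A] [IsNoetherianRing A] [CommRing O] [IsNoetherianRing O]
  [IsLocalRing O] [Algebra A O]

/-- A nonzerodivisor on the closed fibre of a flat quotient stays one modulo every ideal of the
base. The proof is Noetherian induction on `a`, from larger ideals to smaller ones, starting at the
contraction `m` of the maximal ideal. -/
theorem mul_mem_imp_mem_of_colonFlat {J : Ideal O} {f : O} (hFl : ColonFlat A J)
    (hreg : ∀ x, f * x ∈ ((IsLocalRing.maximalIdeal O).comap (algebraMap A O)).map
      (algebraMap A O) ⊔ J → x ∈ ((IsLocalRing.maximalIdeal O).comap (algebraMap A O)).map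
      (algebraMap A O) ⊔ J) (a : Ideal A) :
    ∀ x, f * x ∈ a.map (algebraMap A O) ⊔ J → x ∈ a.map (algebraMap A O) ⊔ J := by
  set m := (IsLocalRing.maximalIdeal O).comap (algebraMap A O) with hm
  induction a using WellFoundedGT.induction with
  | ind a ih =>
  by_cases hatop : a ≤ m
  swap
  · obtain ⟨t, hta, htm⟩ := Set.not_subset.1 hatop
    have hu : IsUnit (algebraMap A O t) := by
      by_contra hu
      exact htm ((IsLocalRing.mem_maximalIdeal _).2 hu)
    have : a.map (algebraMap A O) = ⊤ :=
      Ideal.eq_top_of_isUnit_mem _ (Ideal.mem_map_of_mem _ hta) hu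
    intro x _
    simp [this]
  by_cases ham : a = m
  · rw [ham]; exact hreg
  obtain ⟨t, htm, hta⟩ := SetLike.exists_of_lt (lt_of_le_of_ne hatop ham)
  set N : Ideal O := (a.map (algebraMap A O) ⊔ J).colonElem f with hN
  have hmap : (a ⊔ Ideal.span {t}).map (algebraMap A O) ⊔ J =
      (a.map (algebraMap A O) ⊔ J) ⊔ Ideal.span {algebraMap A O t} := by
    rw [Ideal.map_sup, Ideal.map_span, Set.image_singleton]
    ac_rfl
  have hlt : a < a ⊔ Ideal.span {t} := by
    refine lt_of_le_of_ne le_sup_left fun h => hta ?_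
    have : t ∈ a ⊔ Ideal.span {t} := Ideal.mem_sup_right (Ideal.mem_span_singleton_self t)
    rwa [← h] at this
  -- The induction hypothesis for `a + (t)` gives `x ≡ t y`. Then `t f y` lies in `aO + J`, and
  -- flatness moves `f y` into `(a : t)O + J`.
  have key : ∀ x ∈ N, ∃ y, x - algebraMap A O t * y ∈ a.map (algebraMap A O) ⊔ J ∧
      f * y ∈ (a.colonElem t).map (algebraMap A O) ⊔ J := by
    intro x hx
    have h1 : f * x ∈ (a ⊔ Ideal.span {t}).map (algebraMap A O) ⊔ J := by
      rw [hmap]; exact Ideal.mem_sup_left hx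
    have h2 := ih _ hlt x h1
    rw [hmap, Ideal.mem_sup_span_singleton_iff] at h2
    obtain ⟨y, hy⟩ := h2
    refine ⟨y, hy, hFl _ _ _ ?_⟩
    have := Ideal.sub_mem _ (Ideal.mem_colonElem.1 hx) (Ideal.mul_mem_left _ f hy)
    convert this using 1
    ring
  have hale : a ≤ a.colonElem t := fun r hr => a.mul_mem_left _ hr
  -- If `(a : t)` is strictly larger than `a`, induction puts `y` in `(a : t)O + J`, and multiplying
  -- by `t` returns to `aO + J`. If it equals `a`, then `y` is again in `N`, so `N ⊆ (aO + J) + tN`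
  -- and Nakayama's lemma applies.
  rcases hale.lt_or_eq with hlt' | heq
  · intro x hx
    obtain ⟨y, hy, hfy⟩ := key x hx
    have h3 := ih _ hlt' y hfy
    have h4 : algebraMap A O t * y ∈ a.map (algebraMap A O) ⊔ J := by
      obtain ⟨u, hu, w, hw, rfl⟩ := Submodule.mem_sup.1 h3
      rw [mul_add]
      refine Ideal.add_mem _ (Ideal.mem_sup_left ?_) (Ideal.mem_sup_right (J.mul_mem_left _ hw))
      have : Ideal.span {algebraMap A O t} * (a.colonElem t).map (algebraMap A O) ≤
          a.map (algebraMap A O) := by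
        rw [← Set.image_singleton, ← Ideal.map_span, ← Ideal.map_mul]
        refine Ideal.map_mono (Ideal.mul_le.2 ?_)
        intro r hr s hs
        obtain ⟨z, rfl⟩ := Ideal.mem_span_singleton'.1 hr
        rw [mul_assoc]
        exact a.mul_mem_left _ hs
      exact this (Ideal.mul_mem_mul (Ideal.mem_span_singleton_self _) hu)
    simpa using Ideal.add_mem _ hy h4
  · have hNle : N ≤ a.map (algebraMap A O) ⊔ J := by
      refine Submodule.le_of_le_smul_of_le_jacobson_bot (I := Ideal.span {algebraMap A O t})
        (IsNoetherian.noetherian _) ?_ ?_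
      · rw [IsLocalRing.jacobson_eq_maximalIdeal _ bot_ne_top, Ideal.span_singleton_le_iff_mem]
        exact htm
      · intro x hx
        obtain ⟨y, hy, hfy⟩ := key x hx
        rw [← heq] at hfy
        have := Submodule.add_mem_sup hy (Submodule.smul_mem_smul
          (Ideal.mem_span_singleton_self (algebraMap A O t)) (show y ∈ N from hfy))
        simpa using this
    exact fun x hx => hNle hx

/-- A sequence that is regular on the closed fibre of a flat local algebra has flat quotient. -/
theorem colonFlat_of_regularSeqAt {S : Submonoid O} (hS : ∀ s ∈ S, IsUnit s) (l : List O) :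
    ∀ {J : Ideal O}, ColonFlat A J →
    RegularSeqAt S (((IsLocalRing.maximalIdeal O).comap (algebraMap A O)).map
      (algebraMap A O) ⊔ J) l → ColonFlat A (J ⊔ Ideal.ofList l) ∧
      RegularSeqAt S J l := by
  induction l with
  | nil => intro J h _; exact ⟨by simpa using h, trivial⟩
  | cons f l ih =>
    intro J h hl
    have hreg := mul_mem_imp_mem_of_colonFlat h (f := f) (fun x hx => by
      obtain ⟨s, hs, hsx⟩ := hl.1 x hx
      exact (Ideal.unit_mul_mem_iff_mem _ (hS s hs)).1 hsx)
    have h2 := h.sup_span_singleton hreg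
    have := ih h2 (by rw [← sup_assoc]; exact hl.2)
    refine ⟨by rw [Ideal.ofList_cons, ← sup_assoc]; exact this.1, ⟨?_, this.2⟩⟩
    intro y hy
    refine ⟨1, S.one_mem, ?_⟩
    rw [one_mul]
    simpa using hreg ⊥ y (by simpa using hy)

end LocalFlat

theorem regularSeqAt_append {T : Type*} [CommRing T] {S : Submonoid T} (l l' : List T) :
    ∀ {b : Ideal T}, RegularSeqAt S b (l ++ l') ↔
      RegularSeqAt S b l ∧ RegularSeqAt S (b ⊔ Ideal.ofList l) l' := by
  induction l with
  | nil => intro b; simp [RegularSeqAt]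
  | cons f l ih =>
    intro b
    rw [List.cons_append, RegularSeqAt, ih, RegularSeqAt, Ideal.ofList_cons, ← sup_assoc, and_assoc]

/-! ### Descent to Noetherian local subrings -/

/-- Localize the `ℤ`-subalgebra generated by `G` at the contraction of the maximal ideal of `V`. -/
theorem exists_noetherian_local_subring (V : Type u) [CommRing V] [IsDomain V] [IsLocalRing V]
    (G : Finset V) : ∃ (A : Type u) (_ : CommRing A) (_ : IsNoetherianRing A) (_ : IsLocalRing A)
      (_ : Algebra A V), Function.Injective (algebraMap A V) ∧ IsLocalHom (algebraMap A V) ∧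
      ∀ g ∈ G, g ∈ (algebraMap A V).range := by
  let V₀ := Algebra.adjoin ℤ (G : Set V)
  have : IsNoetherianRing V₀ := isNoetherianRing_of_fg (Subalgebra.fg_adjoin_finset G)
  let P := (IsLocalRing.maximalIdeal V).comap (algebraMap V₀ V)
  have hunit : ∀ y : P.primeCompl, IsUnit (algebraMap V₀ V y) := fun y => by
    by_contra h
    exact y.2 ((IsLocalRing.mem_maximalIdeal _).2 h)
  let φ : Localization.AtPrime P →+* V := IsLocalization.lift (M := P.primeCompl) hunit
  let _ : Algebra (Localization.AtPrime P) V := φ.toAlgebra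
  have hφ : ∀ x, φ (algebraMap V₀ _ x) = algebraMap V₀ V x := IsLocalization.lift_eq hunit
  refine ⟨Localization.AtPrime P, inferInstance, inferInstance, inferInstance, inferInstance,
    ?_, ⟨?_⟩, ?_⟩
  · refine (injective_iff_map_eq_zero _).2 fun x hx => ?_
    obtain ⟨a, s, rfl⟩ := IsLocalization.exists_mk'_eq P.primeCompl x
    have h1 : φ (IsLocalization.mk' _ a s) * φ (algebraMap V₀ _ s) = φ (algebraMap V₀ _ a) := by
      rw [← map_mul, IsLocalization.mk'_spec]
    have h2 : φ (IsLocalization.mk' _ a s) = 0 := hx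
    rw [h2, zero_mul, hφ] at h1
    have : a = 0 := Subtype.ext h1.symm
    rw [this, IsLocalization.mk'_zero]
  · intro x hx
    obtain ⟨a, s, rfl⟩ := IsLocalization.exists_mk'_eq P.primeCompl x
    have h1 : φ (IsLocalization.mk' _ a s) * φ (algebraMap V₀ _ s) = φ (algebraMap V₀ _ a) := by
      rw [← map_mul, IsLocalization.mk'_spec]
    have h2 : IsUnit (φ (IsLocalization.mk' (Localization.AtPrime P) a s)) := hx
    have h3 : IsUnit (algebraMap V₀ V a) := by
      rw [← hφ, ← h1]
      exact h2.mul (by rw [hφ]; exact hunit s)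
    rw [IsLocalization.AtPrime.isUnit_mk'_iff (Localization.AtPrime P) P]
    exact fun h => (IsLocalRing.mem_maximalIdeal _).1 h h3
  · intro g hg
    exact ⟨algebraMap V₀ _ ⟨g, Algebra.subset_adjoin hg⟩, hφ _⟩

theorem MvPolynomial.exists_map_eq_of_coeff_mem_range {R S σ : Type*} [CommRing R] [CommRing S]
    {f : R →+* S} {p : MvPolynomial σ S} (h : ∀ m ∈ p.support, p.coeff m ∈ f.range) :
    ∃ p₀, MvPolynomial.map f p₀ = p := by
  change p ∈ Set.range (MvPolynomial.map f)
  rw [MvPolynomial.mem_range_map_iff_coeffs_subset]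
  intro r hr
  obtain ⟨m, hm, rfl⟩ := MvPolynomial.mem_coeffs_iff.1 hr
  exact h m hm

theorem MvPolynomial.exists_finset_lift_list {V : Type u} [CommRing V] {σ : Type*}
    (l : List (MvPolynomial σ V)) : ∃ G : Finset V, ∀ (A : Type u) [CommRing A] [Algebra A V],
      (∀ g ∈ G, g ∈ (algebraMap A V).range) →
        ∃ l₀ : List (MvPolynomial σ A), l₀.map (MvPolynomial.map (algebraMap A V)) = l := by
  classical
  induction l with
  | nil => exact ⟨∅, fun A _ _ _ => ⟨[], rfl⟩⟩
  | cons p l ih =>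
    obtain ⟨G, hG⟩ := ih
    refine ⟨G ∪ p.support.image (fun m => p.coeff m), fun A _ _ hA => ?_⟩
    obtain ⟨l₀, rfl⟩ := hG A fun g hg => hA g (Finset.mem_union_left _ hg)
    obtain ⟨p₀, rfl⟩ := MvPolynomial.exists_map_eq_of_coeff_mem_range (f := algebraMap A V)
      (p := p) fun m hm => hA _ (Finset.mem_union_right _ (Finset.mem_image_of_mem _ hm))
    exact ⟨p₀ :: l₀, rfl⟩

/-- The coefficients of the multipliers in an expression of `z` by `l` are the only elements of `V`
needed; injectivity then carries the identity down to `A`. -/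
theorem Ideal.exists_finset_mem_ofList {V : Type u} [CommRing V] {σ : Type*}
    (l : List (MvPolynomial σ V)) : ∀ z ∈ Ideal.ofList l, ∃ G : Finset V,
      ∀ (A : Type u) [CommRing A] [Algebra A V], Function.Injective (algebraMap A V) →
      (∀ g ∈ G, g ∈ (algebraMap A V).range) → ∀ (l₀ : List (MvPolynomial σ A)) z₀,
      l₀.map (MvPolynomial.map (algebraMap A V)) = l → MvPolynomial.map (algebraMap A V) z₀ = z →
      z₀ ∈ Ideal.ofList l₀ := by
  classical
  induction l with
  | nil =>
    intro z hz
    refine ⟨∅, fun A _ _ hinj _ l₀ z₀ hl hz0 => ?_⟩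
    have : z = 0 := by simpa using hz
    rw [this] at hz0
    have : z₀ = 0 := MvPolynomial.map_injective _ hinj (by rw [hz0, map_zero])
    rw [this]; exact Ideal.zero_mem _
  | cons f l ih =>
    intro z hz
    rw [Ideal.ofList_cons, sup_comm, Ideal.mem_sup_span_singleton_iff] at hz
    obtain ⟨a, ha⟩ := hz
    obtain ⟨G, hG⟩ := ih _ ha
    refine ⟨G ∪ a.support.image (fun m => a.coeff m), fun A _ _ hinj hA l₀ z₀ hl hz0 => ?_⟩
    obtain ⟨f₀, l₁, rfl, hf, hl1⟩ := List.map_eq_cons_iff.1 hl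
    obtain ⟨a₀, rfl⟩ := MvPolynomial.exists_map_eq_of_coeff_mem_range (f := algebraMap A V)
      (p := a) fun m hm => hA _ (Finset.mem_union_right _ (Finset.mem_image_of_mem _ hm))
    rw [Ideal.ofList_cons, sup_comm, Ideal.mem_sup_span_singleton_iff]
    exact ⟨a₀, hG A hinj (fun g hg => hA g (Finset.mem_union_left _ hg)) _ _ hl1
      (by simp [hf, hz0])⟩

section Descent

variable {A V : Type*} [CommRing A] [CommRing V] [IsLocalRing A] [IsLocalRing V] [Algebra A V]
  [IsLocalHom (algebraMap A V)] {σ : Type*}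

attribute [local instance] MvPolynomial.algebraMvPolynomial in
-- Modulo the maximal ideals this is flatness of the residue field extension: the colon ideal of `y`
-- commutes with it. If every multiplier from `A` fell into `q`, the extended colon ideal, which
-- contains the image of `s`, would lie in the image of `q`.
theorem exists_mul_mem_of_map_mul_mem {q : Ideal (MvPolynomial σ V)}
    (hq : (IsLocalRing.maximalIdeal V).map MvPolynomial.C ≤ q) {b : Ideal (MvPolynomial σ A)}
    (hb : (IsLocalRing.maximalIdeal A).map MvPolynomial.C ≤ b) {s : MvPolynomial σ V} (hs : s ∉ q)
    {y : MvPolynomial σ A} (hy : s * MvPolynomial.map (algebraMap A V) y ∈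
      b.map (MvPolynomial.map (algebraMap A V)) ⊔
        (IsLocalRing.maximalIdeal V).map MvPolynomial.C) :
    ∃ s₀, MvPolynomial.map (algebraMap A V) s₀ ∉ q ∧ s₀ * y ∈ b := by
  let κ := IsLocalRing.ResidueField A
  let k := IsLocalRing.ResidueField V
  let ρA : MvPolynomial σ A →+* MvPolynomial σ κ := MvPolynomial.map (IsLocalRing.residue A)
  let ρV : MvPolynomial σ V →+* MvPolynomial σ k := MvPolynomial.map (IsLocalRing.residue V)
  have hAs : Function.Surjective ρA := MvPolynomial.map_surjective _ IsLocalRing.residue_surjective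
  have hVs : Function.Surjective ρV := MvPolynomial.map_surjective _ IsLocalRing.residue_surjective
  have hAk : RingHom.ker ρA = (IsLocalRing.maximalIdeal A).map MvPolynomial.C := by
    rw [MvPolynomial.ker_map, IsLocalRing.ker_residue]
  have hVk : RingHom.ker ρV = (IsLocalRing.maximalIdeal V).map MvPolynomial.C := by
    rw [MvPolynomial.ker_map, IsLocalRing.ker_residue]
  have hcomm : ∀ z, algebraMap (MvPolynomial σ κ) (MvPolynomial σ k) (ρA z) =
      ρV (MvPolynomial.map (algebraMap A V) z) := by
    intro z
    simp only [MvPolynomial.algebraMap_def, ρA, ρV, MvPolynomial.map_map]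
    congr 1
  have hflat : Module.Flat (MvPolynomial σ κ) (MvPolynomial σ k) :=
    Module.Flat.isBaseChange κ (MvPolynomial σ κ) k (MvPolynomial σ k)
      (Algebra.IsPushout.out (R := κ) (S := MvPolynomial σ κ) (R' := k) (S' := MvPolynomial σ k))
  have h1 : algebraMap (MvPolynomial σ κ) (MvPolynomial σ k) (ρA y) * ρV s ∈
      (b.map ρA).map (algebraMap (MvPolynomial σ κ) (MvPolynomial σ k)) := by
    have h2 := Ideal.mem_map_of_mem ρV hy
    rw [Ideal.map_sup, ← hVk, (RingHom.ker ρV).map_eq_bot_iff_le_ker ρV |>.2 le_rfl, sup_bot_eq,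
      map_mul, mul_comm, ← hcomm, Ideal.map_map] at h2
    rw [Ideal.map_map]
    convert h2 using 2
    exact RingHom.ext hcomm
  have h3 := Ideal.mem_map_colonElem_of_flat _ _ _ h1
  by_contra hcon
  push Not at hcon
  have h4 : ((b.map ρA).colonElem (ρA y)).map
      (algebraMap (MvPolynomial σ κ) (MvPolynomial σ k)) ≤ q.map ρV := by
    refine Ideal.map_le_iff_le_comap.2 fun r hr => ?_
    obtain ⟨r, rfl⟩ := hAs r
    rw [Ideal.mem_colonElem, ← map_mul, ← Ideal.mem_comap, Ideal.comap_map_of_surjective' _ hAs,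
      hAk, sup_eq_left.2 hb, mul_comm] at hr
    rw [Ideal.mem_comap, hcomm]
    refine Ideal.mem_map_of_mem _ ?_
    by_contra h
    exact hcon r h hr
  have h5 := h4 h3
  rw [← Ideal.mem_comap, Ideal.comap_map_of_surjective' _ hVs, hVk, sup_eq_left.2 hq] at h5
  exact hs h5

theorem regularSeqAt_of_map {q : Ideal (MvPolynomial σ V)} [q.IsPrime]
    (hq : (IsLocalRing.maximalIdeal V).map MvPolynomial.C ≤ q) (l : List (MvPolynomial σ A)) :
    ∀ {b : Ideal (MvPolynomial σ A)},
    (IsLocalRing.maximalIdeal A).map MvPolynomial.C ≤ b →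
    RegularSeqAt q.primeCompl (b.map (MvPolynomial.map (algebraMap A V)) ⊔
        (IsLocalRing.maximalIdeal V).map MvPolynomial.C)
        (l.map (MvPolynomial.map (algebraMap A V))) →
    RegularSeqAt (q.comap (MvPolynomial.map (algebraMap A V))).primeCompl b l := by
  induction l with
  | nil => intro b _ _; trivial
  | cons f l ih =>
    intro b hb h
    refine ⟨fun y hy => ?_, ih (hb.trans le_sup_left) ?_⟩
    · obtain ⟨s, hs, hsy⟩ := h.1 (MvPolynomial.map (algebraMap A V) y) (by
        rw [← map_mul]
        exact Ideal.mem_sup_left (Ideal.mem_map_of_mem _ hy))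
      exact exists_mul_mem_of_map_mul_mem hq hb hs hsy
    · have := h.2
      rw [Ideal.map_sup, Ideal.map_span, Set.image_singleton]
      convert this using 1
      ac_rfl

end Descent

theorem RegularSeqAt.localization {T : Type*} [CommRing T] {S : Submonoid T} (O : Type*)
    [CommRing O] [Algebra T O] [IsLocalization S O] (l : List T) : ∀ {b : Ideal T},
    RegularSeqAt S b l →
    RegularSeqAt (⊥ : Submonoid O) (b.map (algebraMap T O)) (l.map (algebraMap T O)) := by
  induction l with
  | nil => intro b _; trivial
  | cons f l ih =>
    intro b h
    refine ⟨fun y hy => ⟨1, Submonoid.one_mem _, ?_⟩, ?_⟩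
    · rw [one_mul]
      obtain ⟨x, s, rfl⟩ := IsLocalization.exists_mk'_eq S y
      rw [IsLocalization.mk'_mem_map_algebraMap_iff S]
      rw [← IsLocalization.mk'_one (M := S) O f, ← IsLocalization.mk'_mul,
        IsLocalization.mk'_mem_map_algebraMap_iff S] at hy
      obtain ⟨t, ht, hty⟩ := hy
      obtain ⟨r, hr, hry⟩ := h.1 (t * x) (by convert hty using 1; ring)
      exact ⟨r * t, S.mul_mem hr ht, by rwa [mul_assoc]⟩
    · have := ih h.2
      rwa [Ideal.map_sup, Ideal.map_span, Set.image_singleton] at this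


section Valuation

variable {V : Type u} [CommRing V] [IsDomain V] [IsLocalRing V] {σ : Type*} [Finite σ]
  {q : Ideal (MvPolynomial σ V)} [q.IsPrime]

/-- A relation between finitely many polynomials may be studied over a Noetherian local subring,
where sequences that are regular on the closed fibre have flat quotients. -/
theorem exists_noetherian_model (hq : q.comap MvPolynomial.C = IsLocalRing.maximalIdeal V)
    {l : List (MvPolynomial σ V)}
    (hl : RegularSeqAt q.primeCompl ((IsLocalRing.maximalIdeal V).map MvPolynomial.C) l)
    (x z : MvPolynomial σ V) (c : V) (l' : List (MvPolynomial σ V)) (hz : z ∈ Ideal.ofList l') :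
    ∃ (A : Type u) (_ : CommRing A) (_ : Algebra A V) (_ : Function.Injective (algebraMap A V))
      (c₀ : A) (x₀ z₀ : MvPolynomial σ A) (l₀ l₀' : List (MvPolynomial σ A)),
      algebraMap A V c₀ = c ∧ MvPolynomial.map (algebraMap A V) x₀ = x ∧
      MvPolynomial.map (algebraMap A V) z₀ = z ∧
      l₀.map (MvPolynomial.map (algebraMap A V)) = l ∧
      l₀'.map (MvPolynomial.map (algebraMap A V)) = l' ∧ z₀ ∈ Ideal.ofList l₀' ∧
      RegularSeqAt (q.comap (MvPolynomial.map (algebraMap A V))).primeCompl ⊥ l₀ ∧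
      ∀ (t : A) y, MvPolynomial.C t * y ∈ Ideal.ofList l₀ → t ≠ 0 →
        ∃ s ∈ (q.comap (MvPolynomial.map (algebraMap A V))).primeCompl, s * y ∈ Ideal.ofList l₀ := by
  classical
  obtain ⟨G₁, hG₁⟩ := MvPolynomial.exists_finset_lift_list l
  obtain ⟨G₂, hG₂⟩ := MvPolynomial.exists_finset_lift_list l'
  obtain ⟨G₃, hG₃⟩ := MvPolynomial.exists_finset_lift_list [x]
  obtain ⟨G₄, hG₄⟩ := MvPolynomial.exists_finset_lift_list [z]
  obtain ⟨G₅, hG₅⟩ := Ideal.exists_finset_mem_ofList l' z hz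
  obtain ⟨A, _, _, _, _, hinj, _, hA⟩ :=
    exists_noetherian_local_subring V (G₁ ∪ G₂ ∪ G₃ ∪ G₄ ∪ G₅ ∪ {c})
  obtain ⟨l₀, rfl⟩ := hG₁ A fun g hg => hA g (by simp [hg])
  obtain ⟨l₀', rfl⟩ := hG₂ A fun g hg => hA g (by simp [hg])
  obtain ⟨lx, hx⟩ := hG₃ A fun g hg => hA g (by simp [hg])
  obtain ⟨lz, hlz⟩ := hG₄ A fun g hg => hA g (by simp [hg])
  obtain ⟨x₀, _, rfl, hx₀, _⟩ := List.map_eq_cons_iff.1 hx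
  obtain ⟨z₀, _, rfl, hz₀, _⟩ := List.map_eq_cons_iff.1 hlz
  obtain ⟨c₀, hc₀⟩ := hA c (by simp)
  set q₀ := q.comap (MvPolynomial.map (algebraMap A V)) with hq₀
  have hqm : (IsLocalRing.maximalIdeal V).map MvPolynomial.C ≤ q :=
    Ideal.map_le_iff_le_comap.2 hq.ge
  have hq₀C : q₀.comap MvPolynomial.C = IsLocalRing.maximalIdeal A := by
    rw [hq₀, Ideal.comap_comap, MvPolynomial.map_comp_C, ← Ideal.comap_comap, hq]
    exact IsLocalRing.maximalIdeal_comap (algebraMap A V)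
  have hreg₀ : RegularSeqAt q₀.primeCompl ((IsLocalRing.maximalIdeal A).map MvPolynomial.C) l₀ := by
    refine regularSeqAt_of_map hqm l₀ le_rfl ?_
    rwa [sup_eq_right.2]
    rw [Ideal.map_map, MvPolynomial.map_comp_C, ← Ideal.map_map]
    refine Ideal.map_mono (Ideal.map_le_iff_le_comap.2 ?_)
    exact (IsLocalRing.maximalIdeal_comap (algebraMap A V)).ge
  -- `O` is a Noetherian local ring, flat over `A`, with contracted maximal ideal that of `A`, so
  -- the local criterion applies to `l₀`.
  let O := Localization.AtPrime q₀
  have hflat : Module.Flat A O := Module.Flat.trans A (MvPolynomial σ A) O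
  have hmO : ((IsLocalRing.maximalIdeal O).comap (algebraMap A O)).map (algebraMap A O) =
      ((IsLocalRing.maximalIdeal A).map MvPolynomial.C).map (algebraMap (MvPolynomial σ A) O) := by
    have hu : (IsLocalRing.maximalIdeal O).comap (algebraMap (MvPolynomial σ A) O) = q₀ :=
      Localization.AtPrime.under_maximalIdeal
    rw [IsScalarTower.algebraMap_eq A (MvPolynomial σ A) O, ← Ideal.comap_comap, hu,
      ← Ideal.map_map, MvPolynomial.algebraMap_eq, hq₀C]
  have hregO := hreg₀.localization O
  rw [← hmO, ← sup_bot_eq (Ideal.map _ _)] at hregO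
  have hfin := colonFlat_of_regularSeqAt (A := A) (S := (⊥ : Submonoid O))
    (fun s hs => by rw [Submonoid.mem_bot.1 hs]; exact isUnit_one) _ ColonFlat.bot_of_flat hregO
  have hback : ∀ (m : List (MvPolynomial σ A)) (y : MvPolynomial σ A),
      algebraMap _ O y ∈ Ideal.ofList (m.map (algebraMap _ O)) →
      ∃ s ∈ q₀.primeCompl, s * y ∈ Ideal.ofList m := by
    intro m y hy
    rw [← Ideal.map_ofList] at hy
    exact (IsLocalization.algebraMap_mem_map_algebraMap_iff q₀.primeCompl O _ _).1 hy
  refine ⟨A, _, _, hinj, c₀, x₀, z₀, l₀, l₀', hc₀, hx₀, hz₀, rfl, rfl,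
    hG₅ A hinj (fun g hg => hA g (by simp [hg])) _ _ rfl hz₀, ?_, ?_⟩
  -- The auxiliary list `n` accumulates the relations already divided out.
  · have key : ∀ (m : List (MvPolynomial σ A)) (n : List (MvPolynomial σ A)),
        RegularSeqAt ⊥ (Ideal.ofList (n.map (algebraMap _ O))) (m.map (algebraMap _ O)) →
        RegularSeqAt q₀.primeCompl (Ideal.ofList n) m := by
      intro m
      induction m with
      | nil => intro n _; trivial
      | cons f m ih =>
        intro n h
        refine ⟨fun y hy => ?_, ?_⟩
        · obtain ⟨s, hs, hsy⟩ := h.1 (algebraMap _ O y) (by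
            rw [← map_mul, ← Ideal.map_ofList]
            exact Ideal.mem_map_of_mem _ hy)
          rw [Submonoid.mem_bot.1 hs, one_mul] at hsy
          exact hback _ _ hsy
        · have := ih (n ++ [f]) (by simpa using h.2)
          simpa using this
    simpa using key l₀ [] (by simpa using hfin.2)
  · intro t y hty ht
    refine hback _ _ ?_
    have h1 := hfin.1 ⊥ t (algebraMap _ O y) (by
      rw [Ideal.map_bot, bot_sup_eq, bot_sup_eq, ← Ideal.map_ofList,
        IsScalarTower.algebraMap_apply A (MvPolynomial σ A) O, ← map_mul]
      exact Ideal.mem_map_of_mem _ hty)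
    have h2 : (⊥ : Ideal A).colonElem t = ⊥ := by
      have := hinj.isDomain (algebraMap A V)
      refine le_bot_iff.1 fun r hr => ?_
      exact (mul_eq_zero.1 ((Submodule.mem_bot _).1 (Ideal.mem_colonElem.1 hr))).resolve_left ht
    rwa [h2, Ideal.map_bot, bot_sup_eq, bot_sup_eq] at h1

/-- The quotient of `T_q` by `l` has no `V`-torsion: the relation lives over a Noetherian model,
where the quotient is flat over a domain. -/
theorem exists_mul_mem_ofList_of_C_mul_mem
    (hq : q.comap MvPolynomial.C = IsLocalRing.maximalIdeal V) {l : List (MvPolynomial σ V)}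
    (hl : RegularSeqAt q.primeCompl ((IsLocalRing.maximalIdeal V).map MvPolynomial.C) l)
    {c : V} (hc : c ≠ 0) {x : MvPolynomial σ V} (hx : MvPolynomial.C c * x ∈ Ideal.ofList l) :
    ∃ s ∈ q.primeCompl, s * x ∈ Ideal.ofList l := by
  obtain ⟨A, _, _, hinj, c₀, x₀, z₀, l₀, l₀', rfl, rfl, hz, rfl, hl', hz₀, -, h⟩ :=
    exists_noetherian_model hq hl x _ c l hx
  obtain rfl : l₀' = l₀ :=
    List.map_injective_iff.2 (MvPolynomial.map_injective _ hinj) hl'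
  obtain rfl : z₀ = MvPolynomial.C c₀ * x₀ :=
    MvPolynomial.map_injective _ hinj (by rw [hz]; simp)
  obtain ⟨s, hs, hsx⟩ := h c₀ x₀ hz₀ (by rintro rfl; simp at hc)
  refine ⟨_, hs, ?_⟩
  rw [← map_mul, ← Ideal.map_ofList]
  exact Ideal.mem_map_of_mem _ hsx

/-- Each relation `f x ∈ (l)` involves finitely many coefficients, so it can be tested over a
Noetherian model chosen for it; the model may vary with `x`. -/
theorem RegularSeqAt.of_residual
    (hq : q.comap MvPolynomial.C = IsLocalRing.maximalIdeal V) (l : List (MvPolynomial σ V))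
    (hl : RegularSeqAt q.primeCompl ((IsLocalRing.maximalIdeal V).map MvPolynomial.C) l) :
    RegularSeqAt q.primeCompl ⊥ l := by
  induction l using List.reverseRecOn with
  | nil => trivial
  | append_singleton l f ih =>
    refine (regularSeqAt_append _ _).2 ⟨ih ((regularSeqAt_append _ _).1 hl).1, ⟨?_, trivial⟩⟩
    rw [bot_sup_eq]
    intro x hx
    obtain ⟨A, _, _, hinj, c₀, x₀, z₀, l₁, l₀, -, rfl, hz, hl₁, rfl, hz₀, h, -⟩ :=
      exists_noetherian_model hq hl x _ 0 l hx
    obtain ⟨l₂, lf, rfl, hl₂, hlf⟩ := List.map_eq_append_iff.1 hl₁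
    obtain ⟨f₀, _, rfl, rfl, hnil⟩ := List.map_eq_cons_iff.1 hlf
    obtain rfl := List.map_eq_nil_iff.1 hnil
    obtain rfl : l₂ = l₀ := List.map_injective_iff.2 (MvPolynomial.map_injective _ hinj) hl₂
    obtain rfl : z₀ = f₀ * x₀ := MvPolynomial.map_injective _ hinj (by rw [hz]; simp)
    obtain ⟨s, hs, hsx⟩ := ((regularSeqAt_append _ _).1 h).2.1 x₀ (by rwa [bot_sup_eq])
    refine ⟨_, hs, ?_⟩
    rw [← map_mul, ← Ideal.map_ofList]
    rw [bot_sup_eq] at hsx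
    exact Ideal.mem_map_of_mem _ hsx

end Valuation

/-! ### Nagata's finiteness theorem over a valuation ring -/

namespace MvPolynomial

section Homogeneous

variable {V : Type*} [CommRing V] [IsDomain V] [ValuationRing V] {τ : Type*}

/-- Divisibility is total in `V`, so one element of the maximal ideal divides all the finitely many
coefficients. -/
theorem exists_mem_maximalIdeal_C_mul (w : MvPolynomial τ V)
    (hw : w ∈ (IsLocalRing.maximalIdeal V).map C) :
    ∃ b ∈ IsLocalRing.maximalIdeal V, ∃ w', w = C b * w' := by
  classical
  rw [mem_map_C_iff] at hw
  have key : ∀ s : Finset (τ →₀ ℕ), ∃ b ∈ IsLocalRing.maximalIdeal V, ∀ m ∈ s, b ∣ w.coeff m := by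
    intro s
    induction s using Finset.induction_on with
    | empty => exact ⟨0, Ideal.zero_mem _, by simp⟩
    | insert m s _ ih =>
      obtain ⟨b, hb, hbs⟩ := ih
      rcases ValuationRing.dvd_total b (w.coeff m) with h | h
      · exact ⟨b, hb, fun n hn => by
          rcases Finset.mem_insert.1 hn with rfl | hn
          exacts [h, hbs n hn]⟩
      · exact ⟨_, hw m, fun n hn => by
          rcases Finset.mem_insert.1 hn with rfl | hn
          exacts [dvd_rfl, h.trans (hbs n hn)]⟩
  obtain ⟨b, hb, hbs⟩ := key w.support
  obtain ⟨w', hw'⟩ := (C_dvd_iff_dvd_coeff b w).2 fun m => by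
    by_cases hm : m ∈ w.support
    · exact hbs m hm
    · rw [notMem_support_iff.1 hm]; exact dvd_zero _
  exact ⟨b, hb, w', hw'⟩

/-- The image is finitely generated and torsion-free over a valuation ring, hence free, hence
finitely presented. This gives finite generation of the graded pieces below. -/
theorem finite_of_isTorsionFree_fg_ker {M N : Type*} [AddCommGroup M] [Module V M]
    [Module.Finite V M] [AddCommGroup N] [Module V N] [Module.IsTorsionFree V N] (f : M →ₗ[V] N) :
    (LinearMap.ker f).FG := by
  have : Module.IsTorsionFree V (LinearMap.range f) := inferInstance
  have : Module.Flat V (LinearMap.range f) :=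
    Module.Flat.flat_iff_torsion_eq_bot_of_isBezout.2
      (Submodule.isTorsionFree_iff_torsion_eq_bot.1 this)
  have : Module.Free V (LinearMap.range f) := Module.free_of_flat_of_isLocalRing
  have : Module.FinitePresentation V (LinearMap.range f) :=
    Module.finitePresentation_of_projective V _
  have := Module.FinitePresentation.fg_ker f.rangeRestrict f.surjective_rangeRestrict
  rwa [LinearMap.ker_rangeRestrict] at this

/-- The degree `d` part of an ideal of a polynomial ring. -/
def degreePart {R σ : Type*} [CommRing R] (H : Ideal (MvPolynomial σ R)) (d : ℕ) :
    Submodule R (MvPolynomial σ R) where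
  carrier := {F | F ∈ H ∧ F.IsHomogeneous d}
  add_mem' hp hq := ⟨H.add_mem hp.1 hq.1, hp.2.add hq.2⟩
  zero_mem' := ⟨H.zero_mem, isHomogeneous_zero _ _ _⟩
  smul_mem' c F hF := by
    rw [smul_eq_C_mul]
    refine ⟨H.mul_mem_left _ hF.1, ?_⟩
    simpa using (isHomogeneous_C σ c).mul hF.2

attribute [local instance] MvPolynomial.gradedAlgebra in
/-- A saturated homogeneous ideal of a polynomial ring over a valuation ring is finitely
generated. -/
theorem fg_of_saturated_of_homogeneous [Finite τ] (H : Ideal (MvPolynomial τ V))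
    (hH : ∀ F ∈ H, ∀ d, homogeneousComponent d F ∈ H)
    (hsat : ∀ c : V, c ≠ 0 → ∀ F, C c * F ∈ H → F ∈ H)
    (hfg : ∀ d, (degreePart H d).FG) : H.FG := by
  classical
  obtain ⟨ρ, hρs, hρk⟩ : ∃ ρ : MvPolynomial τ V →+* MvPolynomial τ (IsLocalRing.ResidueField V),
      Function.Surjective ρ ∧ RingHom.ker ρ = (IsLocalRing.maximalIdeal V).map C :=
    ⟨map (IsLocalRing.residue V), map_surjective _ IsLocalRing.residue_surjective, by
      rw [ker_map, IsLocalRing.ker_residue]⟩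
  -- The polynomial ring over the residue field is Noetherian, so some finite set of homogeneous
  -- elements of `H` has a maximal image there; it will generate `H`.
  let Ω : Set (Ideal (MvPolynomial τ (IsLocalRing.ResidueField V))) :=
    {J | ∃ T : Finset (MvPolynomial τ V), (∀ t ∈ T, t ∈ H ∧ ∃ d, t.IsHomogeneous d) ∧
      J = (Ideal.span (T : Set (MvPolynomial τ V))).map ρ}
  obtain ⟨J, ⟨T, hT, rfl⟩, hmax⟩ := (wellFounded_gt (α :=
    Ideal (MvPolynomial τ (IsLocalRing.ResidueField V)))).has_min Ω ⟨_, ∅, by simp, rfl⟩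
  set H' := Ideal.span (T : Set (MvPolynomial τ V)) with hH'
  have hH'H : H' ≤ H := Ideal.span_le.2 fun t ht => (hT t ht).1
  have hhom : H'.IsHomogeneous (homogeneousSubmodule τ V) :=
    Ideal.homogeneous_span _ _ fun t ht => (hT t ht).2
  have hcomp : ∀ d, ∀ f ∈ H, f.IsHomogeneous d → ρ f ∈ H'.map ρ := by
    intro d f hf hfd
    by_contra hcon
    have hmem : (Ideal.span ((insert f T : Finset (MvPolynomial τ V)) :
        Set (MvPolynomial τ V))).map ρ ∈ Ω := by
      refine ⟨insert f T, ?_, rfl⟩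
      intro t ht
      rcases Finset.mem_insert.1 ht with rfl | ht
      exacts [⟨hf, d, hfd⟩, hT t ht]
    refine hmax _ hmem ?_
    · refine lt_of_le_of_ne (Ideal.map_mono (Ideal.span_mono (by simp))) fun h => hcon ?_
      rw [h]
      exact Ideal.mem_map_of_mem _ (Ideal.subset_span (by simp))
  have hdeg : ∀ d, degreePart H d ≤ degreePart H' d := by
    intro d
    -- Nakayama in each degree: by saturation, the part of `g` divisible by `b ∈ m` is `b` times an
    -- element of `H`, so `H_d ⊆ H'_d + m H_d`.
    refine Submodule.le_of_le_smul_of_le_jacobson_bot (I := IsLocalRing.maximalIdeal V) (hfg d)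
      (IsLocalRing.maximalIdeal_le_jacobson _) ?_
    rintro g ⟨hgH, hgd⟩
    have h1 := hcomp d g hgH hgd
    rw [← Ideal.mem_comap, Ideal.comap_map_of_surjective' _ hρs, hρk] at h1
    obtain ⟨h', hh', w, hw, hsum⟩ := Submodule.mem_sup.1 h1
    have hw' : homogeneousComponent d w ∈ (IsLocalRing.maximalIdeal V).map C := by
      rw [mem_map_C_iff] at hw ⊢
      intro m
      rw [coeff_homogeneousComponent]
      split_ifs
      exacts [hw m, Ideal.zero_mem _]
    have hgsum : g = homogeneousComponent d h' + homogeneousComponent d w := by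
      rw [← map_add, hsum, homogeneousComponent_eq_self hgd]
    have hh'd : homogeneousComponent d h' ∈ H' := homogeneousComponent_mem_of_mem hhom hh' d
    have hwH : homogeneousComponent d w ∈ H := by
      have := H.sub_mem hgH (hH'H hh'd)
      rwa [hgsum, add_sub_cancel_left] at this
    rw [hgsum]
    refine Submodule.add_mem_sup ⟨hh'd, homogeneousComponent_isHomogeneous d h'⟩ ?_
    obtain ⟨b, hb, w', hbw⟩ := exists_mem_maximalIdeal_C_mul _ hw'
    by_cases hb0 : b = 0
    · rw [hbw, hb0]; simp
    · have hw'H : w' ∈ H := hsat b hb0 _ (hbw ▸ hwH)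
      have hw'd : w'.IsHomogeneous d := by
        intro m hm
        refine (homogeneousComponent_isHomogeneous d w) (d := m) ?_
        rw [hbw, coeff_C_mul]
        exact mul_ne_zero hb0 hm
      rw [hbw, ← smul_eq_C_mul]
      exact Submodule.smul_mem_smul hb ⟨hw'H, hw'd⟩
  refine ⟨T, le_antisymm hH'H fun F hF => ?_⟩
  rw [← sum_homogeneousComponent F]
  exact Ideal.sum_mem _ fun d _ =>
    (hdeg d ⟨hH F hF d, homogeneousComponent_isHomogeneous d F⟩).1

end Homogeneous

section Nagata

theorem _root_.Finset.prod_mul_pow_eq {ι B : Type*} [CommRing B] (s : Finset ι) (a : ι → B)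
    (e : ι → ℕ) (x : B) :
    ∏ i ∈ s, (a i * x) ^ e i = (∏ i ∈ s, a i ^ e i) * x ^ ∑ i ∈ s, e i := by
  simp only [mul_pow, Finset.prod_mul_distrib, Finset.prod_pow_eq_pow_sum]

variable {V : Type*} [CommRing V] {σ : Type*}

/-- Setting the homogenizing variable `none` equal to `1`. -/
noncomputable def dehomogenize : MvPolynomial (Option σ) V →ₐ[V] MvPolynomial σ V :=
  aeval fun o => o.elim 1 X

/-- The graded map whose kernel is the homogenization of the kernel of `q`. -/
noncomputable def reesMap {B : Type*} [CommRing B] [Algebra V B] (q : MvPolynomial σ V →ₐ[V] B) :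
    MvPolynomial (Option σ) V →ₐ[V] Polynomial B :=
  aeval fun o => Polynomial.C (q (dehomogenize (X o))) * Polynomial.X

theorem coeff_reesMap {B : Type*} [CommRing B] [Algebra V B] (q : MvPolynomial σ V →ₐ[V] B)
    (F : MvPolynomial (Option σ) V) (d : ℕ) :
    (reesMap q F).coeff d = q (dehomogenize (homogeneousComponent d F)) := by
  classical
  induction F using MvPolynomial.induction_on' with
  | monomial m c =>
    have h1 : reesMap q (monomial m c) =
        Polynomial.C (q (dehomogenize (monomial m c))) * Polynomial.X ^ m.degree := by
      have : q (dehomogenize (monomial m c)) = algebraMap V B c *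
          ∏ o ∈ m.support, q (dehomogenize (X o)) ^ m o := by
        rw [monomial_eq, map_mul, Finsupp.prod, map_prod, map_mul, map_prod]
        simp [dehomogenize]
      rw [reesMap, aeval_monomial, this, map_mul, map_prod, Finsupp.prod,
        Finset.prod_mul_pow_eq, Finsupp.degree_apply, mul_assoc]
      simp only [map_pow]
      rfl
    rw [h1, Polynomial.coeff_C_mul, Polynomial.coeff_X_pow]
    by_cases h : d = m.degree
    · rw [if_pos h, mul_one, homogeneousComponent_eq_self (h ▸ isHomogeneous_monomial c rfl)]
    · rw [if_neg h, mul_zero, homogeneousComponent_of_mem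
        (show monomial m c ∈ homogeneousSubmodule _ _ m.degree from isHomogeneous_monomial c rfl),
        if_neg h, map_zero, map_zero]
  | add p q hp hq => simp [hp, hq]

theorem exists_homogenization (g : MvPolynomial σ V) :
    ∃ d F, F.IsHomogeneous d ∧ dehomogenize F = g := by
  classical
  refine ⟨g.totalDegree, ∑ m ∈ g.support, monomial (m.mapDomain some +
    Finsupp.single none (g.totalDegree - m.degree)) (g.coeff m), ?_, ?_⟩
  · refine IsHomogeneous.sum _ _ _ fun m hm => isHomogeneous_monomial _ ?_
    have h1 : m.degree ≤ g.totalDegree := le_totalDegree hm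
    rw [map_add, Finsupp.degree_mapDomain, Finsupp.degree_single]
    omega
  · conv_rhs => rw [g.as_sum]
    rw [map_sum]
    refine Finset.sum_congr rfl fun m _ => ?_
    rw [dehomogenize, aeval_monomial, Finsupp.prod_add_index' (by simp) (by simp [pow_add]),
      Finsupp.prod_mapDomain_index (by simp) (by simp [pow_add]), Finsupp.prod_single_index (by simp)]
    simp [algebraMap_eq, monomial_eq]

/-- **Nagata**: an ideal of a polynomial ring over a valuation ring with torsion-free quotient is
finitely generated. -/
theorem fg_of_saturated (I : Ideal (MvPolynomial σ V)) [IsDomain V] [ValuationRing V] [Finite σ]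
    (hI : ∀ c : V, c ≠ 0 → ∀ g, C c * g ∈ I → g ∈ I) : I.FG := by
  have htf : Module.IsTorsionFree V (MvPolynomial σ V ⧸ I) := by
    refine Module.IsTorsionFree.of_smul_eq_zero fun c x hx => ?_
    obtain ⟨g, rfl⟩ := Ideal.Quotient.mk_surjective x
    by_cases hc : c = 0
    · exact Or.inl hc
    · refine Or.inr (Ideal.Quotient.eq_zero_iff_mem.2 (hI c hc g ?_))
      rw [← Ideal.Quotient.eq_zero_iff_mem, ← hx, ← smul_eq_C_mul]
      rfl
  let H : Ideal (MvPolynomial (Option σ) V) := RingHom.ker (reesMap (Ideal.Quotient.mkₐ V I))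
  have hmem : ∀ F, F ∈ H ↔ ∀ d, dehomogenize (homogeneousComponent d F) ∈ I := by
    intro F
    rw [RingHom.mem_ker, Polynomial.ext_iff]
    exact forall_congr' fun d => by
      rw [coeff_reesMap, Polynomial.coeff_zero, Ideal.Quotient.mkₐ_eq_mk, Ideal.Quotient.eq_zero_iff_mem]
  have hmemd : ∀ F d, F.IsHomogeneous d → (F ∈ H ↔ dehomogenize F ∈ I) := by
    intro F d hF
    rw [hmem]
    refine ⟨fun h => ?_, fun h e => ?_⟩
    · have := h d
      rwa [homogeneousComponent_eq_self hF] at this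
    · rw [homogeneousComponent_of_mem ((mem_homogeneousSubmodule _ _).2 hF)]
      split_ifs
      · exact h
      · simp
  have hHfg : H.FG := by
    refine fg_of_saturated_of_homogeneous H (fun F hF d => ?_) (fun c hc F hF => ?_) fun d => ?_
    · rw [hmemd _ d (homogeneousComponent_isHomogeneous d F)]
      exact (hmem F).1 hF d
    · rw [hmem] at hF ⊢
      intro d
      have := hF d
      rw [homogeneousComponent_C_mul, map_mul] at this
      refine hI c hc _ ?_
      simpa [dehomogenize, algebraMap_eq] using this
    -- In degree `d` the ideal is the kernel of a map from a finite module to the torsion-free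
    -- module `T/I`.
    · have : Module.Finite V (homogeneousSubmodule (Option σ) V d) :=
        Module.Finite.iff_fg.2 (homogeneousSubmodule_fg _ _ d)
      have h1 := finite_of_isTorsionFree_fg_ker (((Ideal.Quotient.mkₐ V I).comp
        dehomogenize).toLinearMap.comp (homogeneousSubmodule (Option σ) V d).subtype)
      have h2 : degreePart H d = Submodule.map (homogeneousSubmodule (Option σ) V d).subtype
          (LinearMap.ker (((Ideal.Quotient.mkₐ V I).comp dehomogenize).toLinearMap.comp
            (homogeneousSubmodule (Option σ) V d).subtype)) := by
        ext F
        constructor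
        · rintro ⟨h2, h3⟩
          exact ⟨⟨F, h3⟩, Ideal.Quotient.eq_zero_iff_mem.2 ((hmemd F d h3).1 h2), rfl⟩
        · rintro ⟨⟨G, hG⟩, h2, rfl⟩
          exact ⟨(hmemd G d hG).2 (Ideal.Quotient.eq_zero_iff_mem.1 h2), hG⟩
      rw [h2]
      exact h1.map _
  have : I = H.map dehomogenize := by
    refine le_antisymm (fun g hg => ?_) (Ideal.map_le_iff_le_comap.2 fun F hF => ?_)
    · obtain ⟨d, F, hF, rfl⟩ := exists_homogenization g
      exact Ideal.mem_map_of_mem _ ((hmemd F d hF).2 hg)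
    · rw [Ideal.mem_comap, ← sum_homogeneousComponent F, map_sum]
      exact Ideal.sum_mem _ fun d _ => (hmem F).1 hF d
  rw [this]
  exact Ideal.FG.map hHfg _

end Nagata

end MvPolynomial

/-! ### Spreading out from `T_q` to a basic open set -/

theorem RegularSeqAt.mono_powers {T : Type*} [CommRing T] {h h' : T} (hh : h ∣ h') (l : List T) :
    ∀ {b : Ideal T}, RegularSeqAt (Submonoid.powers h) b l →
      RegularSeqAt (Submonoid.powers h') b l := by
  induction l with
  | nil => intro b _; trivial
  | cons f l ih =>
    refine fun {b} H => ⟨fun y hy => ?_, ih H.2⟩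
    obtain ⟨_, ⟨n, rfl⟩, hs⟩ := H.1 y hy
    obtain ⟨d, rfl⟩ := hh
    refine ⟨_, ⟨n, rfl⟩, ?_⟩
    change (h * d) ^ n * y ∈ b
    rw [mul_pow, mul_comm (h ^ n), mul_assoc]
    exact b.mul_mem_left _ hs

theorem Ideal.exists_mul_mem_of_fg {T : Type*} [CommRing T] {S : Submonoid T} {I J : Ideal T}
    (hI : I.FG) (h : ∀ g ∈ I, ∃ s ∈ S, s * g ∈ J) : ∃ s ∈ S, ∀ g ∈ I, s * g ∈ J := by
  classical
  obtain ⟨G, rfl⟩ := hI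
  have key : ∀ F : Finset T, F ⊆ G → ∃ s ∈ S, ∀ g ∈ F, s * g ∈ J := by
    intro F
    induction F using Finset.induction_on with
    | empty => exact fun _ => ⟨1, S.one_mem, by simp⟩
    | insert g F _ ih =>
      intro hF
      obtain ⟨s, hs, hsF⟩ := ih ((Finset.subset_insert _ _).trans hF)
      obtain ⟨t, ht, htg⟩ := h g (Ideal.subset_span (hF (Finset.mem_insert_self _ _)))
      refine ⟨s * t, S.mul_mem hs ht, fun x hx => ?_⟩
      rcases Finset.mem_insert.1 hx with rfl | hx
      · rw [mul_assoc]; exact J.mul_mem_left _ htg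
      · rw [mul_comm s, mul_assoc]; exact J.mul_mem_left _ (hsF x hx)
  obtain ⟨s, hs, hsG⟩ := key G subset_rfl
  refine ⟨s, hs, fun g hg => ?_⟩
  have : Ideal.span (G : Set T) ≤ J.colonElem s := Ideal.span_le.2 hsG
  exact this hg

theorem RegularSeqAt.isWeaklyRegular {R : Type*} [CommRing R] {l : List R}
    (h : RegularSeqAt (⊥ : Submonoid R) ⊥ l) : RingTheory.Sequence.IsWeaklyRegular R l := by
  refine ⟨fun i hi => ?_⟩
  have hl : l = l.take i ++ l[i] :: l.drop (i + 1) := by simp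
  rw [hl, regularSeqAt_append, bot_sup_eq] at h
  rw [isSMulRegular_iff_right_eq_zero_of_smul]
  intro x hx
  obtain ⟨y, rfl⟩ := Submodule.Quotient.mk_surjective _ x
  rw [← Submodule.Quotient.mk_smul, Submodule.Quotient.mk_eq_zero, smul_eq_mul, smul_eq_mul,
    Ideal.mul_top] at hx
  obtain ⟨s, hs, hsy⟩ := h.2.1 y hx
  rw [Submodule.Quotient.mk_eq_zero, smul_eq_mul, Ideal.mul_top]
  rwa [Submonoid.mem_bot.1 hs, one_mul] at hsy

section

variable {V V' : Type*} [CommRing V] [IsDomain V] [ValuationRing V]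

/-- Finite generation replaces Noetherianity here. The colon ideal `(l : f)` lies in its
`V`-saturation `Q`, which is finitely generated by Nagata's theorem. At `q`, absence of torsion
removes the constant and regularity removes `f`, so one denominator moves all of `Q` into `(l)`. -/
theorem exists_regularSeqAt_powers {σ : Type*} [Finite σ] {q : Ideal (MvPolynomial σ V)}
    [q.IsPrime] (hq : q.comap MvPolynomial.C = IsLocalRing.maximalIdeal V)
    (l : List (MvPolynomial σ V))
    (hl : RegularSeqAt q.primeCompl ((IsLocalRing.maximalIdeal V).map MvPolynomial.C) l) :
    ∃ s ∈ q.primeCompl, RegularSeqAt (Submonoid.powers s) ⊥ l := by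
  induction l using List.reverseRecOn with
  | nil => exact ⟨1, Submonoid.one_mem _, trivial⟩
  | append_singleton l f ih =>
    have hl' := ((regularSeqAt_append _ _).1 hl).1
    obtain ⟨s, hs, hreg⟩ := ih hl'
    let Q : Ideal (MvPolynomial σ V) :=
      { carrier := {x | ∃ c : V, c ≠ 0 ∧ MvPolynomial.C c * (f * x) ∈ Ideal.ofList l}
        add_mem' := by
          rintro x y ⟨c, hc, hx⟩ ⟨d, hd, hy⟩
          refine ⟨c * d, mul_ne_zero hc hd, ?_⟩
          have := Ideal.add_mem _ (Ideal.mul_mem_left _ (MvPolynomial.C d) hx)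
            (Ideal.mul_mem_left _ (MvPolynomial.C c) hy)
          convert this using 1
          rw [map_mul]; ring
        zero_mem' := ⟨1, one_ne_zero, by simp⟩
        smul_mem' := by
          rintro r x ⟨c, hc, hx⟩
          refine ⟨c, hc, ?_⟩
          convert Ideal.mul_mem_left _ r hx using 1
          rw [smul_eq_mul]; ring }
    have hQ : Q.FG := MvPolynomial.fg_of_saturated Q fun c hc g hg => by
      obtain ⟨d, hd, hg⟩ := hg
      refine ⟨d * c, mul_ne_zero hd hc, ?_⟩
      convert hg using 1
      rw [map_mul]; ring
    obtain ⟨t, ht, htQ⟩ := Ideal.exists_mul_mem_of_fg (S := q.primeCompl) (J := Ideal.ofList l) hQ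
      fun x hx => by
        obtain ⟨c, hc, hx⟩ := hx
        obtain ⟨s, hs, hsx⟩ := exists_mul_mem_ofList_of_C_mul_mem hq hl' hc hx
        have h2 := ((regularSeqAt_append _ _).1 (RegularSeqAt.of_residual hq _ hl)).2.1
        rw [bot_sup_eq] at h2
        obtain ⟨r, hr, hrx⟩ := h2 (s * x) (by convert hsx using 1; ring)
        exact ⟨r * s, Submonoid.mul_mem _ hr hs, by rwa [mul_assoc]⟩
    refine ⟨s * t, Submonoid.mul_mem _ hs ht, (regularSeqAt_append _ _).2
      ⟨hreg.mono_powers (dvd_mul_right _ _), ⟨fun y hy => ?_, trivial⟩⟩⟩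
    rw [bot_sup_eq] at hy ⊢
    refine ⟨_, ⟨1, rfl⟩, ?_⟩
    change (s * t) ^ 1 * y ∈ _
    rw [pow_one, mul_assoc]
    exact Ideal.mul_mem_left _ _ (htQ y ⟨1, one_ne_zero, by simpa using hy⟩)

variable [CommRing V'] [IsDomain V'] [IsLocalRing V'] [Algebra V V']
  [IsLocalHom (algebraMap V V')]

/-- The subalgebra is the image of `T_h`. Nagata's theorem makes the kernel of `ψ` finitely
generated, so one denominator suffices to bring it into `(j)`. -/
theorem exists_completeIntersection_subalgebra (hinj : Function.Injective (algebraMap V V')) {n : ℕ}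
    (ψ : MvPolynomial (Fin n) V →ₐ[V] V') (j : List (MvPolynomial (Fin n) V))
    (hker : ∀ f ∈ j, ψ f = 0)
    (hreg : RegularSeqAt ((IsLocalRing.maximalIdeal V').comap ψ).primeCompl
      ((IsLocalRing.maximalIdeal V).map MvPolynomial.C) j)
    (hgen : ∀ t, ψ t = 0 → ∃ c : V, c ≠ 0 ∧
      ∃ s ∈ ((IsLocalRing.maximalIdeal V').comap ψ).primeCompl,
        MvPolynomial.C c * s * t ∈ Ideal.ofList j)
    {s₁ : MvPolynomial (Fin n) V}
    (hs₁ : s₁ ∈ ((IsLocalRing.maximalIdeal V').comap ψ).primeCompl) :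
    ∃ C : Subalgebra V V', IsCompleteIntersectionAlgebra V C ∧
      ∀ a y, ψ s₁ * y = ψ a → y ∈ C := by
  set q := (IsLocalRing.maximalIdeal V').comap ψ with hqdef
  have hq : q.comap MvPolynomial.C = IsLocalRing.maximalIdeal V := by
    rw [← IsLocalRing.maximalIdeal_comap (algebraMap V V')]
    ext c
    simp [hqdef, Ideal.mem_comap, ← MvPolynomial.algebraMap_eq]
  have hunit : ∀ t, t ∈ q.primeCompl → IsUnit (ψ t) := fun t ht => by
    by_contra h
    exact ht ((IsLocalRing.mem_maximalIdeal _).2 h)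
  obtain ⟨s₂, hs₂, hI⟩ := Ideal.exists_mul_mem_of_fg (S := q.primeCompl) (J := Ideal.ofList j)
    (MvPolynomial.fg_of_saturated (RingHom.ker ψ) fun c hc g hg => by
      rw [RingHom.mem_ker, map_mul, ← MvPolynomial.algebraMap_eq, AlgHom.commutes] at hg
      exact (mul_eq_zero.1 hg).resolve_left fun h => hc (hinj (by rw [h, map_zero])))
    fun g hg => by
      obtain ⟨c, hc, s, hs, hcs⟩ := hgen g hg
      rw [mul_assoc] at hcs
      obtain ⟨r, hr, hrs⟩ := exists_mul_mem_ofList_of_C_mul_mem hq hreg hc hcs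
      exact ⟨r * s, Submonoid.mul_mem _ hr hs, by rwa [mul_assoc]⟩
  obtain ⟨s₃, hs₃, hreg₃⟩ := exists_regularSeqAt_powers hq j hreg
  -- `s₁` clears the given denominators, `s₂` moves the kernel into `(j)`, and `s₃` makes `j`
  -- regular.
  set h := s₁ * (s₂ * s₃) with hh
  have hhS : h ∈ q.primeCompl :=
    Submonoid.mul_mem _ hs₁ (Submonoid.mul_mem _ hs₂ hs₃)
  have hu : ∀ y : Submonoid.powers h, IsUnit (ψ y) := by
    rintro ⟨_, k, rfl⟩
    rw [map_pow]
    exact (hunit h hhS).pow k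
  let Φ : Localization.Away h →ₐ[V] V' := IsLocalization.liftAlgHom (M := Submonoid.powers h) hu
  have hΦ : ∀ t, Φ (algebraMap _ _ t) = ψ t := fun t => IsLocalization.lift_eq hu t
  set P := j.map (algebraMap _ (Localization.Away h)) with hP
  have hΦker : RingHom.ker Φ = Ideal.ofList P := by
    apply le_antisymm
    · intro x hx
      obtain ⟨a, s, rfl⟩ := IsLocalization.exists_mk'_eq (Submonoid.powers h) x
      have ha : ψ a = 0 := by
        rw [← hΦ, ← IsLocalization.mk'_spec (Localization.Away h) a s, map_mul,
          (RingHom.mem_ker).1 hx, zero_mul]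
      rw [hP, ← Ideal.map_ofList, IsLocalization.mk'_mem_map_algebraMap_iff (Submonoid.powers h)]
      refine ⟨h, Submonoid.mem_powers h, ?_⟩
      have := Ideal.mul_mem_left _ (s₁ * s₃) (hI a ha)
      convert this using 1
      rw [hh]; ring
    · rw [Ideal.ofList, Ideal.span_le]
      intro x hx
      obtain ⟨f, hf, rfl⟩ := List.mem_map.1 hx
      exact (hΦ f).trans (hker f hf)
  refine ⟨Φ.range, ⟨n, h, P, ?_, ⟨?_, ?_⟩, ⟨?_⟩⟩, ?_⟩
  · intro h0
    have := hunit h hhS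
    rw [h0, map_zero] at this
    exact not_isUnit_zero this
  · have := (hreg₃.mono_powers (show s₃ ∣ h from ⟨s₁ * s₂, by rw [hh]; ring⟩)).localization
      (Localization.Away h)
    rw [Ideal.map_bot] at this
    exact this.isWeaklyRegular
  · rw [smul_eq_mul, Ideal.mul_top, ← hΦker]
    exact (RingHom.ker_ne_top Φ).symm
  · exact ((Ideal.quotientKerEquivRange Φ).symm.trans (Ideal.quotientEquivAlgOfEq V hΦker))
  · intro a y hy
    refine ⟨IsLocalization.mk' _ (a * (s₂ * s₃)) ⟨h, Submonoid.mem_powers h⟩, ?_⟩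
    have h1 : Φ (IsLocalization.mk' _ (a * (s₂ * s₃)) ⟨h, Submonoid.mem_powers h⟩) * ψ h =
        ψ (a * (s₂ * s₃)) := by
      rw [← hΦ, ← hΦ, ← map_mul]
      congr 1
      exact IsLocalization.mk'_spec (Localization.Away h) _ ⟨h, Submonoid.mem_powers h⟩
    refine (hunit h hhS).mul_right_cancel (h1.trans ?_)
    rw [map_mul, ← hy, hh, map_mul ψ s₁]
    ring

end

section

open Polynomial

/-! ### Regular sequences after adjoining a variable -/

section RegularPolynomial

variable {T : Type*} [CommRing T] {S : Submonoid T} {S' : Submonoid T[X]}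

theorem Polynomial.exists_C_mul_mem_map_C {b : Ideal T} (y : T[X])
    (h : ∀ n, ∃ s ∈ S, s * y.coeff n ∈ b) : ∃ s ∈ S, C s * y ∈ b.map C := by
  classical
  have key : ∀ F : Finset ℕ, ∃ s ∈ S, ∀ n ∈ F, s * y.coeff n ∈ b := by
    intro F
    induction F using Finset.induction_on with
    | empty => exact ⟨1, S.one_mem, by simp⟩
    | insert n F _ ih =>
      obtain ⟨s, hs, hsF⟩ := ih
      obtain ⟨t, ht, htn⟩ := h n
      refine ⟨s * t, S.mul_mem hs ht, fun k hk => ?_⟩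
      rcases Finset.mem_insert.1 hk with rfl | hk
      · rw [mul_assoc]; exact b.mul_mem_left _ htn
      · rw [mul_comm s, mul_assoc]; exact b.mul_mem_left _ (hsF k hk)
  obtain ⟨s, hs, hsF⟩ := key y.support
  refine ⟨s, hs, Ideal.mem_map_C_iff.2 fun n => ?_⟩
  rw [coeff_C_mul]
  by_cases hn : n ∈ y.support
  · exact hsF n hn
  · rw [notMem_support_iff.1 hn, mul_zero]; exact b.zero_mem

theorem RegularAt.polynomial (hS : ∀ s ∈ S, C s ∈ S') {b : Ideal T} {f : T}
    (h : RegularAt S b f) : RegularAt S' (b.map C) (C f) := by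
  intro y hy
  obtain ⟨s, hs, hsy⟩ := exists_C_mul_mem_map_C (S := S) (b := b) y fun n =>
    h _ (by simpa using Ideal.mem_map_C_iff.1 hy n)
  exact ⟨_, hS s hs, hsy⟩

theorem RegularSeqAt.polynomial (hS : ∀ s ∈ S, C s ∈ S') (l : List T) :
    ∀ {b : Ideal T}, RegularSeqAt S b l → RegularSeqAt S' (b.map C) (l.map C) := by
  induction l with
  | nil => intro b _; trivial
  | cons f l ih =>
    refine fun {b} h => ⟨h.1.polynomial hS, ?_⟩
    have := ih h.2
    rwa [Ideal.map_sup, Ideal.map_span, Set.image_singleton] at this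

/-- McCoy: a polynomial with a unit coefficient is a nonzerodivisor. -/
theorem regularAt_map_C_of_coeff_mem (hS : ∀ s ∈ S, C s ∈ S') (b : Ideal T) {M : T[X]} {k : ℕ}
    (hk : M.coeff k ∈ S) : RegularAt S' (b.map C) M := by
  -- `bS` is the contraction of the localized ideal; modulo it the elements of `S` are
  -- nonzerodivisors. McCoy's theorem then reduces the claim to constants `a` killing every
  -- coefficient of `M`.
  let bS : Ideal T :=
    { carrier := {t | ∃ s ∈ S, s * t ∈ b}
      add_mem' := by
        rintro x y ⟨s, hs, hx⟩ ⟨t, ht, hy⟩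
        refine ⟨s * t, S.mul_mem hs ht, ?_⟩
        convert b.add_mem (b.mul_mem_left t hx) (b.mul_mem_left s hy) using 1
        ring
      zero_mem' := ⟨1, S.one_mem, by simp⟩
      smul_mem' := by
        rintro r x ⟨s, hs, hx⟩
        refine ⟨s, hs, ?_⟩
        convert b.mul_mem_left r hx using 1
        rw [smul_eq_mul]; ring }
  have hM : M.map (Ideal.Quotient.mk bS) ∈ nonZeroDivisors (T ⧸ bS)[X] := by
    refine Polynomial.mem_nonZeroDivisors_iff.2 fun a ha => ?_
    obtain ⟨a, rfl⟩ := Ideal.Quotient.mk_surjective a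
    have h1 := congrArg (fun p => coeff p k) ha
    simp only [coeff_smul, coeff_map, smul_eq_mul, coeff_zero, ← map_mul] at h1
    obtain ⟨s, hs, hsa⟩ := Ideal.Quotient.eq_zero_iff_mem.1 h1
    refine Ideal.Quotient.eq_zero_iff_mem.2 ⟨s * M.coeff k, S.mul_mem hs hk, ?_⟩
    convert hsa using 1
    ring
  intro y hy
  have h2 : (y.map (Ideal.Quotient.mk bS)) * M.map (Ideal.Quotient.mk bS) = 0 := by
    rw [← Polynomial.map_mul, mul_comm]
    ext n
    rw [coeff_map, coeff_zero, Ideal.Quotient.eq_zero_iff_mem]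
    exact ⟨1, S.one_mem, by simpa using Ideal.mem_map_C_iff.1 hy n⟩
  have h3 := (mem_nonZeroDivisors_iff.1 hM).2 _ h2
  obtain ⟨s, hs, hsy⟩ := exists_C_mul_mem_map_C (S := S) (b := b) y fun n => by
    have h4 := congrArg (fun p => coeff p n) h3
    simp only [coeff_map, coeff_zero] at h4
    exact Ideal.Quotient.eq_zero_iff_mem.1 h4
  exact ⟨_, hS s hs, hsy⟩

theorem Ideal.sup_span_singleton_congr {R : Type*} [CommRing R] {b : Ideal R} {f g : R}
    (h : f - g ∈ b) : b ⊔ Ideal.span {f} = b ⊔ Ideal.span {g} := by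
  have key : ∀ {f g : R}, f - g ∈ b → b ⊔ Ideal.span {f} ≤ b ⊔ Ideal.span {g} := by
    intro f g h
    refine sup_le le_sup_left ((Ideal.span_singleton_le_iff_mem _).2 ?_)
    rw [Ideal.mem_sup_span_singleton_iff]
    exact ⟨1, by simpa using h⟩
  exact le_antisymm (key h) (key (by rw [← neg_sub]; exact b.neg_mem h))

theorem RegularAt.congr {R : Type*} [CommRing R] {S : Submonoid R} {b : Ideal R} {f g : R}
    (h : f - g ∈ b) (hg : RegularAt S b g) : RegularAt S b f := fun y hy =>
  hg y (by
    have := b.sub_mem hy (b.mul_mem_right y h)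
    convert this using 1
    ring)

/-- This allows the relations of a stage to be replaced by their reductions, which are free of the
last variable. -/
theorem Ideal.sup_ofList_congr {R : Type*} [CommRing R] {c : Ideal R} {l l' : List R}
    (h : List.Forall₂ (fun f g => f - g ∈ c) l l') : c ⊔ Ideal.ofList l = c ⊔ Ideal.ofList l' := by
  induction h with
  | nil => rfl
  | @cons f g l l' hfg _ ih =>
    rw [Ideal.ofList_cons, Ideal.ofList_cons, ← sup_assoc, ← sup_assoc,
      Ideal.sup_span_singleton_congr hfg, sup_right_comm, ih, sup_right_comm]

end RegularPolynomial

section PolynomialAlgebra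

/-- `T` is a polynomial algebra in finitely many variables. -/
def IsFinitePolynomialAlgebra (V T : Type*) [CommRing V] [CommRing T] [Algebra V T] : Prop :=
  ∃ n : ℕ, Nonempty (T ≃ₐ[V] MvPolynomial (Fin n) V)

theorem IsFinitePolynomialAlgebra.polynomial {V T : Type*} [CommRing V] [CommRing T] [Algebra V T]
    (h : IsFinitePolynomialAlgebra V T) : IsFinitePolynomialAlgebra V T[X] := by
  obtain ⟨n, ⟨e⟩⟩ := h
  exact ⟨n + 1, ⟨(Polynomial.mapAlgEquiv e).trans
    ((MvPolynomial.finSuccEquiv V n).symm.restrictScalars V)⟩⟩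

theorem isFinitePolynomialAlgebra_self (V : Type*) [CommRing V] : IsFinitePolynomialAlgebra V V :=
  ⟨0, ⟨(MvPolynomial.isEmptyAlgEquiv V (Fin 0)).symm⟩⟩

end PolynomialAlgebra

/-! ### Presentations and their extensions -/

section Presentation

variable {V T E K' Γ : Type*} [CommRing V] [CommRing T] [Algebra V T] [CommRing E]
  [Algebra V E] [Field K'] [Algebra V K'] [LinearOrderedCommGroupWithZero Γ]

/-- The elements whose image has value one. -/
def valueOne (v : Valuation K' Γ) (φ : T →ₐ[V] K') : Submonoid T where
  carrier := {t | v (φ t) = 1}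
  one_mem' := by simp
  mul_mem' := by
    intro a b ha hb
    simp only [Set.mem_ofPred_eq, map_mul] at *
    rw [ha, hb, one_mul]

theorem mem_valueOne {v : Valuation K' Γ} {φ : T →ₐ[V] K'} {t : T} :
    t ∈ valueOne v φ ↔ v (φ t) = 1 := Iff.rfl

/-- Extension of `θ` to polynomials by sending the variable to `y`. -/
noncomputable def extendHom (θ : T →ₐ[V] E) (y : E) : T[X] →ₐ[V] E where
  __ := Polynomial.eval₂RingHom (θ : T →+* E) y
  commutes' c := by
    change eval₂ (θ : T →+* E) y (algebraMap V T[X] c) = _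
    rw [Polynomial.algebraMap_apply, eval₂_C]
    exact θ.commutes c

theorem extendHom_apply (θ : T →ₐ[V] E) (y : E) (p : T[X]) :
    extendHom θ y p = eval₂ (θ : T →+* E) y p := rfl

@[simp] theorem extendHom_C (θ : T →ₐ[V] E) (y : E) (t : T) : extendHom θ y (C t) = θ t := by
  simp [extendHom_apply]

@[simp] theorem extendHom_X (θ : T →ₐ[V] E) (y : E) : extendHom θ y X = y := by
  simp [extendHom_apply]

theorem extendHom_le_one {v : Valuation K' Γ} {π : E →ₐ[V] K'} {θ : T →ₐ[V] E}
    (hθ : ∀ t, v (π (θ t)) ≤ 1) {y : E} (hy : v (π y) ≤ 1) (p : T[X]) :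
    v (π (extendHom θ y p)) ≤ 1 := by
  rw [extendHom_apply, eval₂_eq_sum, Polynomial.sum, map_sum]
  refine v.map_sum_le fun n _ => ?_
  rw [map_mul, map_mul, map_pow, map_pow]
  exact mul_le_one' (hθ _) (pow_le_one' hy n)

theorem Ideal.map_algebraMap_polynomial (m : Ideal V) :
    m.map (algebraMap V T[X]) = (m.map (algebraMap V T)).map C := by
  rw [Ideal.map_map]; rfl

variable [IsDomain V]

/-- The products of a nonzero constant and an element whose image has value one. -/
def denoms (v : Valuation K' Γ) (φ : T →ₐ[V] K') : Submonoid T where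
  carrier := {t | ∃ c : V, c ≠ 0 ∧ ∃ s ∈ valueOne v φ, algebraMap V T c * s = t}
  one_mem' := ⟨1, one_ne_zero, 1, Submonoid.one_mem _, by simp⟩
  mul_mem' := by
    rintro _ _ ⟨c, hc, s, hs, rfl⟩ ⟨d, hd, t, ht, rfl⟩
    exact ⟨c * d, mul_ne_zero hc hd, s * t, Submonoid.mul_mem _ hs ht, by rw [map_mul]; ring⟩

theorem valueOne_le_denoms (v : Valuation K' Γ) (φ : T →ₐ[V] K') : valueOne v φ ≤ denoms v φ :=
  fun s hs => ⟨1, one_ne_zero, s, hs, by simp⟩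

theorem algebraMap_mem_denoms (v : Valuation K' Γ) (φ : T →ₐ[V] K') {c : V} (hc : c ≠ 0) :
    algebraMap V T c ∈ denoms v φ :=
  ⟨c, hc, 1, Submonoid.one_mem _, by simp⟩

theorem map_mem_denoms {v : Valuation K' Γ} {T' : Type*} [CommRing T'] [Algebra V T']
    {φ : T →ₐ[V] K'} {φ' : T' →ₐ[V] K'} (f : T →ₐ[V] T') (hf : ∀ t, φ' (f t) = φ t) {t : T}
    (ht : t ∈ denoms v φ) : f t ∈ denoms v φ' := by
  obtain ⟨c, hc, s, hs, rfl⟩ := ht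
  refine ⟨c, hc, f s, ?_, by simp⟩
  rw [mem_valueOne] at hs ⊢
  rw [hf, hs]

/-- The list `j` of relations presents, near the centre of the valuation `v` and up to torsion, the
image of `θ`, and is a regular sequence on the closed fibre there. -/
structure IsPresentation [IsLocalRing V] (v : Valuation K' Γ) (π : E →ₐ[V] K') (θ : T →ₐ[V] E)
    (j : List T) : Prop where
  le_one : ∀ t, v (π (θ t)) ≤ 1
  map_eq_zero : ∀ f ∈ j, θ f = 0
  regular : RegularSeqAt (valueOne v (π.comp θ))
    ((IsLocalRing.maximalIdeal V).map (algebraMap V T)) j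
  generic : ∀ t, θ t = 0 → ∃ s ∈ denoms v (π.comp θ), s * t ∈ Ideal.ofList j

/-- Modulo the relation, `w X` may be replaced by `a`, so a power of `w` eliminates the variable. -/
theorem Polynomial.exists_pow_mul_sub_C_mem_span (w a : T) (t : T[X]) :
    ∃ (n : ℕ) (r : T), C w ^ n * t - C r ∈ Ideal.span {C a - C w * X} := by
  induction t using Polynomial.induction_on with
  | C t => exact ⟨0, t, by simp⟩
  | add p q hp hq =>
    obtain ⟨n, r, hr⟩ := hp
    obtain ⟨m, s, hs⟩ := hq
    refine ⟨n + m, w ^ m * r + w ^ n * s, ?_⟩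
    have := Ideal.add_mem _ (Ideal.mul_mem_left _ (C w ^ m) hr) (Ideal.mul_mem_left _ (C w ^ n) hs)
    convert this using 1
    simp only [map_add, map_mul, map_pow]
    ring
  | monomial n t ih =>
    obtain ⟨m, r, hr⟩ := ih
    refine ⟨m + 1, r * a, ?_⟩
    have := Ideal.sub_mem _ (Ideal.mul_mem_left _ (C w * X) hr)
      (Ideal.mul_mem_left _ (C r) (Ideal.mem_span_singleton_self (C a - C w * X)))
    convert this using 1
    simp only [map_mul]
    ring

variable [IsLocalRing V] {v : Valuation K' Γ} {π : E →ₐ[V] K'} {θ : T →ₐ[V] E} {j : List T}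

/-- Adjoining a variable transcendental over the image. -/
theorem IsPresentation.adjoin_transcendental (h : IsPresentation v π θ j) {F : Type*} [CommRing F]
    [Algebra V F] {π' : F →ₐ[V] K'} {ι : E →ₐ[V] F} (hπ : ∀ e, π' (ι e) = π e) {z : F}
    (hz : v (π' z) ≤ 1)
    (htr : ∀ p : T[X], extendHom (ι.comp θ) z p = 0 → ∀ n, θ (p.coeff n) = 0) :
    IsPresentation v π' (extendHom (ι.comp θ) z) (j.map C) := by
  have hcomp : ∀ t, π'.comp (extendHom (ι.comp θ) z) (CAlgHom (R := V) t) = π.comp θ t := fun t => by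
    simp [hπ]
  refine ⟨extendHom_le_one (fun t => by simpa [hπ] using h.le_one t) hz, ?_, ?_, ?_⟩
  · intro f hf
    obtain ⟨g, hg, rfl⟩ := List.mem_map.1 hf
    simp [h.map_eq_zero g hg]
  · rw [Ideal.map_algebraMap_polynomial]
    refine h.regular.polynomial fun s hs => ?_
    rw [mem_valueOne] at hs ⊢
    rw [← hs, ← hcomp]; rfl
  · intro p hp
    obtain ⟨s, hs, hsp⟩ := exists_C_mul_mem_map_C p fun n => h.generic _ (htr p hp n)
    refine ⟨C s, map_mem_denoms (V := V) CAlgHom hcomp hs, ?_⟩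
    rwa [Ideal.map_ofList] at hsp

/-- Adjoining a root of a linear equation with small leading coefficient. -/
theorem IsPresentation.adjoin_relation (h : IsPresentation v π θ j) {a b : T} {d : V} {y : E}
    (hb : b ∈ valueOne v (π.comp θ)) (hd : d ∈ IsLocalRing.maximalIdeal V) (hd0 : d ≠ 0)
    (hy : v (π y) ≤ 1) (hrel : algebraMap V E d * θ b * y = θ a)
    (hreg : RegularAt (valueOne v (π.comp θ))
      ((IsLocalRing.maximalIdeal V).map (algebraMap V T) ⊔ Ideal.ofList j) a) :
    IsPresentation v π (extendHom θ y) (j.map C ++ [C a - C (algebraMap V T d * b) * X]) := by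
  have hcomp : ∀ t, π.comp (extendHom θ y) (CAlgHom (R := V) t) = π.comp θ t := fun t => by simp
  have hS : ∀ s ∈ valueOne v (π.comp θ), C s ∈ valueOne v (π.comp (extendHom θ y)) := by
    intro s hs
    rw [mem_valueOne] at hs ⊢
    rw [← hs, ← hcomp]; rfl
  have hzero : extendHom θ y (C a - C (algebraMap V T d * b) * X) = 0 := by
    rw [map_sub, map_mul, extendHom_C, extendHom_C, extendHom_X, map_mul, AlgHom.commutes, hrel,
      sub_self]
  refine ⟨extendHom_le_one h.le_one hy, ?_, ?_, ?_⟩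
  · intro f hf
    rcases List.mem_append.1 hf with hf | hf
    · obtain ⟨g, hg, rfl⟩ := List.mem_map.1 hf
      simp [h.map_eq_zero g hg]
    · rw [List.mem_singleton.1 hf, hzero]
  · rw [regularSeqAt_append, Ideal.map_algebraMap_polynomial]
    refine ⟨h.regular.polynomial hS, ⟨?_, trivial⟩⟩
    -- Since `d` lies in the maximal ideal, the new relation reduces on the closed fibre to the
    -- constant polynomial `a`.
    rw [← Ideal.map_ofList, ← Ideal.map_sup]
    refine (hreg.polynomial hS).congr ?_
    rw [sub_sub_cancel_left, map_mul]
    refine neg_mem (Ideal.mul_mem_right _ _ (Ideal.mul_mem_right _ _ (Ideal.mem_map_of_mem _ ?_)))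
    exact Ideal.mem_sup_left (Ideal.mem_map_of_mem _ hd)
  · intro t ht
    -- A power of `d b`, which is an allowed denominator, reduces an element of the kernel to one
    -- without the new variable.
    obtain ⟨n, r, hr⟩ := exists_pow_mul_sub_C_mem_span (algebraMap V T d * b) a t
    have hr0 : θ r = 0 := by
      have hle : Ideal.span {C a - C (algebraMap V T d * b) * X} ≤ RingHom.ker (extendHom θ y) := by
        rw [Ideal.span_singleton_le_iff_mem]; exact hzero
      have := (RingHom.mem_ker).1 (hle hr)
      rw [map_sub, map_mul, ht, mul_zero, zero_sub, neg_eq_zero, extendHom_C] at this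
      exact this
    obtain ⟨s, hs, hsr⟩ := h.generic r hr0
    have hw : algebraMap V T d * b ∈ denoms v (π.comp θ) := ⟨d, hd0, b, hb, rfl⟩
    refine ⟨C (s * (algebraMap V T d * b) ^ n),
      map_mem_denoms (V := V) CAlgHom hcomp (Submonoid.mul_mem _ hs (Submonoid.pow_mem _ hw n)), ?_⟩
    rw [Ideal.ofList_append, Ideal.ofList_singleton, ← Ideal.map_ofList]
    have h1 := Ideal.mem_map_of_mem C hsr
    have h2 := Ideal.mul_mem_left _ (C s) hr
    have := Submodule.add_mem_sup h1 h2
    convert this using 1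
    simp only [map_mul, map_pow]
    ring

/-- Pushing a presentation forward along `π` when `π` is injective on the image. -/
theorem IsPresentation.push_of_injective (h : IsPresentation v π θ j)
    (hinj : ∀ t, π (θ t) = 0 → θ t = 0) :
    IsPresentation v (AlgHom.id V K') (π.comp θ) j :=
  ⟨h.le_one, fun f hf => by simp [h.map_eq_zero f hf], h.regular,
    fun t ht => h.generic t (hinj t ht)⟩

/-- Pushing a presentation forward along `π` when the kernel is generated by one relation. -/
theorem IsPresentation.push_of_relation (h : IsPresentation v π θ j) {a : T} (ha : π (θ a) = 0)
    (hreg : RegularAt (valueOne v (π.comp θ))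
      ((IsLocalRing.maximalIdeal V).map (algebraMap V T) ⊔ Ideal.ofList j) a)
    (hgen : ∀ t, π (θ t) = 0 → ∃ s ∈ denoms v (π.comp θ), ∃ r, θ (s * t) = θ (a * r)) :
    IsPresentation v (AlgHom.id V K') (π.comp θ) (j ++ [a]) := by
  refine ⟨h.le_one, ?_, (regularSeqAt_append _ _).2 ⟨h.regular, hreg, trivial⟩, fun t ht => ?_⟩
  · intro f hf
    rcases List.mem_append.1 hf with hf | hf
    · simp [h.map_eq_zero f hf]
    · rw [List.mem_singleton.1 hf]; exact ha
  · obtain ⟨s, hs, r, hsr⟩ := hgen t ht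
    obtain ⟨u, hu, hur⟩ := h.generic (s * t - a * r) (by rw [map_sub, hsr, sub_self])
    refine ⟨u * s, Submonoid.mul_mem _ hu hs, ?_⟩
    rw [Ideal.ofList_append, Ideal.ofList_singleton]
    have := Submodule.add_mem_sup hur
      (Ideal.mul_mem_left _ (u * r) (Ideal.mem_span_singleton_self a))
    convert this using 1
    ring

theorem RegularSeqAt.comap_equiv {R R' : Type*} [CommRing R] [CommRing R'] (e : R ≃+* R')
    {S : Submonoid R} {S' : Submonoid R'} (hS : ∀ s ∈ S, e s ∈ S') (l : List R) :
    ∀ {b : Ideal R}, RegularSeqAt S b l →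
      RegularSeqAt S' (b.map (e : R →+* R')) (l.map e) := by
  induction l with
  | nil => intro b _; trivial
  | cons f l ih =>
    intro b H
    have hmem : ∀ x, e x ∈ b.map (e : R →+* R') ↔ x ∈ b := fun x => by
      change x ∈ (b.map (e : R →+* R')).comap (e : R →+* R') ↔ x ∈ b
      rw [Ideal.comap_map_of_bijective (e : R →+* R') e.bijective]
    refine ⟨fun y hy => ?_, ?_⟩
    · obtain ⟨y, rfl⟩ := e.surjective y
      rw [← map_mul, hmem] at hy
      obtain ⟨s, hs, hsy⟩ := H.1 y hy
      exact ⟨e s, hS s hs, by rwa [← map_mul, hmem]⟩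
    · have := ih H.2
      rwa [Ideal.map_sup, Ideal.map_span, Set.image_singleton] at this

theorem IsPresentation.comp_equiv (h : IsPresentation v π θ j) {T' : Type*} [CommRing T']
    [Algebra V T'] (e : T ≃ₐ[V] T') :
    IsPresentation v π (θ.comp (e.symm : T' →ₐ[V] T)) (j.map e) := by
  refine ⟨fun t => h.le_one _, ?_, ?_, ?_⟩
  · intro f hf
    obtain ⟨g, hg, rfl⟩ := List.mem_map.1 hf
    simp [h.map_eq_zero g hg]
  · have := h.regular.comap_equiv (e : T ≃+* T')
      (S' := valueOne v (π.comp (θ.comp (e.symm : T' →ₐ[V] T)))) (fun s hs => by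
        rw [mem_valueOne] at hs ⊢
        simpa using hs)
    rw [Ideal.map_map] at this
    convert this using 2
    · ext c
      simp
    · rfl
  · intro t ht
    obtain ⟨s, hs, hst⟩ := h.generic (e.symm t) ht
    refine ⟨e s, map_mem_denoms (e : T →ₐ[V] T') (fun t => by simp) hs, ?_⟩
    have := Ideal.mem_map_of_mem (e : T →+* T') hst
    rw [Ideal.map_ofList] at this
    simpa using this

end Presentation

/-! ### Normalized polynomials and jumps of the low degree rings -/

theorem Polynomial.exists_adic_expansion {L : Type*} [Field L] {ψ : L[X]} (hψ : ψ.Monic)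
    (hpos : 0 < ψ.natDegree) (φ : L[X]) :
    ∃ P : L[X][X], (∀ k, (P.coeff k).degree < ψ.degree) ∧ P.eval ψ = φ := by
  induction hn : φ.natDegree using Nat.strong_induction_on generalizing φ with
  | _ n ih =>
    have hbot : (⊥ : WithBot ℕ) < ψ.degree := by
      rw [bot_lt_iff_ne_bot, Ne, degree_eq_bot]; exact hψ.ne_zero
    by_cases hlt : φ.degree < ψ.degree
    · refine ⟨C φ, fun k => ?_, by simp⟩
      rw [coeff_C]
      split_ifs
      · exact hlt
      · simpa using hbot
    · have hle : ψ.natDegree ≤ φ.natDegree := natDegree_le_natDegree (not_lt.1 hlt)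
      obtain ⟨P, hP, hPφ⟩ := ih (φ /ₘ ψ).natDegree (by
        rw [natDegree_divByMonic _ hψ]; omega) (φ /ₘ ψ) rfl
      refine ⟨P * X + C (φ %ₘ ψ), fun k => ?_, ?_⟩
      · rcases k with _ | k
        · simpa using degree_modByMonic_lt φ hψ
        · simpa [coeff_C] using hP k
      · simp only [eval_add, eval_mul, eval_X, eval_C, hPφ]
        rw [mul_comm, add_comm]
        exact modByMonic_add_div φ ψ

section Valued

variable {L K' Γ : Type*} [Field L] [Field K'] [Algebra L K'] [LinearOrderedCommGroupWithZero Γ]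

/-- The ring generated by the polynomials of degree less than `s` which are integral at `x`. -/
noncomputable def lowDegreeRing (v : Valuation K' Γ) (x : K') (s : ℕ) : Subring L[X] :=
  Subring.closure {g | g.degree < s ∧ v (aeval x g) ≤ 1}

variable {v : Valuation K' Γ} {x : K'}

theorem mem_lowDegreeRing {s : ℕ} {g : L[X]} (h : g.degree < s) (h' : v (aeval x g) ≤ 1) :
    g ∈ lowDegreeRing v x s :=
  Subring.subset_closure ⟨h, h'⟩

theorem lowDegreeRing_mono {s t : ℕ} (h : s ≤ t) :
    lowDegreeRing (L := L) v x s ≤ lowDegreeRing v x t :=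
  Subring.closure_mono fun _ hg => ⟨hg.1.trans_le (by exact_mod_cast h), hg.2⟩

theorem le_one_of_mem_lowDegreeRing {s : ℕ} {g : L[X]} (h : g ∈ lowDegreeRing v x s) :
    v (aeval x g) ≤ 1 := by
  have : lowDegreeRing v x s ≤ v.integer.comap (aeval x : L[X] →ₐ[L] K').toRingHom :=
    Subring.closure_le.2 fun g hg => hg.2
  exact this h

theorem exists_C_of_mem_lowDegreeRing_one {g : L[X]} (h : g ∈ lowDegreeRing v x 1) :
    ∃ a : L, v (algebraMap L K' a) ≤ 1 ∧ g = C a := by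
  have h1 : lowDegreeRing v x 1 ≤ (C : L →+* L[X]).range := by
    refine Subring.closure_le.2 fun g hg => ⟨g.coeff 0, (eq_C_of_degree_le_zero ?_).symm⟩
    exact Nat.WithBot.lt_one_iff_le_zero.1 (by exact_mod_cast hg.1)
  obtain ⟨a, rfl⟩ := h1 h
  exact ⟨a, by simpa using le_one_of_mem_lowDegreeRing h, rfl⟩

theorem lowDegreeRing_two_ne_one (hx : v x ≤ 1) :
    lowDegreeRing (L := L) v x 2 ≠ lowDegreeRing v x 1 := by
  intro h
  have hX : (X : L[X]) ∈ lowDegreeRing v x 2 :=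
    mem_lowDegreeRing (by rw [degree_X]; exact_mod_cast one_lt_two) (by simpa using hx)
  rw [h] at hX
  obtain ⟨a, -, ha⟩ := exists_C_of_mem_lowDegreeRing_one hX
  exact X_ne_C a ha

/-- Every stage is reached at the last degree where the rings grow. -/
theorem exists_jump (hx : v x ≤ 1) {s : ℕ} (hs : 2 ≤ s) : ∃ q, 1 ≤ q ∧ q < s ∧
    lowDegreeRing (L := L) v x (q + 1) ≠ lowDegreeRing v x q ∧
      lowDegreeRing (L := L) v x s = lowDegreeRing v x (q + 1) := by
  induction s, hs using Nat.le_induction with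
  | base => exact ⟨1, le_rfl, one_lt_two, lowDegreeRing_two_ne_one hx, rfl⟩
  | succ s hs ih =>
    by_cases h : lowDegreeRing (L := L) v x (s + 1) = lowDegreeRing v x s
    · obtain ⟨q, h1, h2, h3, h4⟩ := ih
      exact ⟨q, h1, h2.trans (Nat.lt_succ_self s), h3, h.trans h4⟩
    · exact ⟨s, by omega, Nat.lt_succ_self s, h, rfl⟩

variable {K : Type*} [Field K] [Algebra K L] [Algebra K K'] [IsScalarTower K L K']

/-- `ψ` scaled by the constant `e`, to be used when `e` and `ψ(x)` have the same value. -/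
noncomputable def scaled (e : K) (ψ : L[X]) : L[X] := C (algebraMap K L e⁻¹) * ψ

theorem C_mul_scaled {e : K} (he : e ≠ 0) (ψ : L[X]) : C (algebraMap K L e) * scaled e ψ = ψ := by
  rw [scaled, ← mul_assoc, ← C_mul, ← map_mul, mul_inv_cancel₀ he, map_one, C_1, one_mul]

theorem aeval_scaled (e : K) (ψ : L[X]) :
    aeval x (scaled e ψ) = (algebraMap K K' e)⁻¹ * aeval x ψ := by
  rw [scaled, map_mul, aeval_C, ← IsScalarTower.algebraMap_apply, map_inv₀]

theorem aeval_scaled_eq_one {e : K} {ψ : L[X]} (he : e ≠ 0)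
    (h : v (algebraMap K K' e) = v (aeval x ψ)) : v (aeval x (scaled e ψ)) = 1 := by
  rw [aeval_scaled, map_mul, map_inv₀, ← h, inv_mul_cancel₀]
  rw [Valuation.ne_zero_iff]
  exact (_root_.map_ne_zero _).2 he

theorem exists_ne_zero_value_eq (hval : ∀ y : K', y ≠ 0 → ∃ c : K, v (algebraMap K K' c) = v y)
    {y : K'} (hy : y ≠ 0) : ∃ c : K, c ≠ 0 ∧ v (algebraMap K K' c) = v y := by
  obtain ⟨c, hc⟩ := hval y hy
  refine ⟨c, ?_, hc⟩
  rintro rfl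
  rw [map_zero, map_zero] at hc
  exact hy ((Valuation.zero_iff v).1 hc.symm)

/-- Normalized expansion of `φ` in powers of `ψ`. -/
theorem exists_normalized_expansion
    (hval : ∀ y : K', y ≠ 0 → ∃ c : K, v (algebraMap K K' c) = v y) {N : ℕ}
    (hN : ∀ g : L[X], g ≠ 0 → g.natDegree < N → aeval x g ≠ 0) {q : ℕ} (hq : 1 ≤ q) (hqN : q < N)
    {ψ : L[X]} (hψ : ψ.Monic) (hψq : ψ.natDegree = q) {e : K} (he : e ≠ 0) {φ : L[X]}
    (hφ : φ ≠ 0) : ∃ (μ : K) (P : L[X][X]), μ ≠ 0 ∧ (∀ k, P.coeff k ∈ lowDegreeRing v x q) ∧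
      (∃ k, v (aeval x (P.coeff k)) = 1) ∧ P.eval (scaled e ψ) = scaled μ φ := by
  obtain ⟨P₀, hP₀, hP₀φ⟩ := exists_adic_expansion hψ (by omega) φ
  -- Because `ψ = e * (ψ / e)`, passing to powers of `ψ / e` multiplies the `k`-th coefficient by `e
  -- ^ k`.
  set P₁ := P₀.comp (C (C (algebraMap K L e)) * X) with hP₁
  have hcoef : ∀ k, P₁.coeff k = P₀.coeff k * C (algebraMap K L e ^ k) := fun k => by
    rw [hP₁, comp_C_mul_X_coeff, map_pow]
  have heval : P₁.eval (scaled e ψ) = φ := by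
    rw [hP₁, eval_comp, eval_mul, eval_C, eval_X, C_mul_scaled he, hP₀φ]
  have hdeg : ∀ k, (P₁.coeff k).degree < q := fun k => by
    rw [hcoef, ← hψq, ← degree_eq_natDegree hψ.ne_zero]
    refine lt_of_le_of_lt ?_ (hP₀ k)
    refine (degree_mul_le _ _).trans ?_
    exact (add_le_add le_rfl degree_C_le).trans (by simp)
  have hne : P₁ ≠ 0 := by
    rintro h
    rw [h, eval_zero] at heval
    exact hφ heval.symm
  -- Dividing by a constant with the largest coefficient value makes all coefficients integral at
  -- `x` and one of value one.
  obtain ⟨k₀, hk₀, hmax⟩ := Finset.exists_max_image P₁.support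
    (fun k => v (aeval x (P₁.coeff k))) (support_nonempty.2 hne)
  have hk₀' : aeval x (P₁.coeff k₀) ≠ 0 := by
    refine hN _ (mem_support_iff.1 hk₀) (lt_trans ?_ hqN)
    exact (natDegree_lt_iff_degree_lt (mem_support_iff.1 hk₀)).2 (hdeg k₀)
  obtain ⟨μ, hμ, hμv⟩ := exists_ne_zero_value_eq hval hk₀'
  refine ⟨μ, C (C (algebraMap K L μ⁻¹)) * P₁, hμ, fun k => ?_, ⟨k₀, ?_⟩, ?_⟩
  · rw [coeff_C_mul]
    refine mem_lowDegreeRing ?_ ?_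
    · refine lt_of_le_of_lt ?_ (hdeg k)
      refine (degree_mul_le _ _).trans ?_
      exact (add_le_add degree_C_le le_rfl).trans (by simp)
    · by_cases hk : k ∈ P₁.support
      · change v (aeval x (scaled μ _)) ≤ 1
        rw [aeval_scaled, map_mul, map_inv₀, hμv]
        exact inv_mul_le_one_of_le₀ (hmax k hk) zero_le
      · rw [notMem_support_iff.1 hk]; simp
  · rw [coeff_C_mul]
    exact aeval_scaled_eq_one hμ hμv
  · rw [eval_mul, eval_C, heval]; rfl

/-- Finitely many elements of the ring at level `q + 1` are polynomials over the ring at level `q`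
in a single normalized polynomial of degree `q`. -/
theorem exists_normal_form
    (hval : ∀ y : K', y ≠ 0 → ∃ c : K, v (algebraMap K K' c) = v y) {N : ℕ}
    (hN : ∀ g : L[X], g ≠ 0 → g.natDegree < N → aeval x g ≠ 0) {q : ℕ} (hq : 1 ≤ q) (hqN : q < N)
    (hjump : lowDegreeRing (L := L) v x (q + 1) ≠ lowDegreeRing v x q) (F : Finset L[X])
    (hF : ∀ f ∈ F, f ∈ lowDegreeRing v x (q + 1)) :
    ∃ (ψ : L[X]) (e : K), ψ.Monic ∧ ψ.natDegree = q ∧ e ≠ 0 ∧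
      v (aeval x (scaled e ψ)) ≤ 1 ∧ scaled e ψ ∉ lowDegreeRing v x q ∧
      ∀ f ∈ F, f ∈ (eval₂RingHom (lowDegreeRing v x q).subtype (scaled e ψ)).range := by
  classical
  let Good : L[X] × K → Prop := fun p =>
    p.1.Monic ∧ p.1.natDegree = q ∧ p.2 ≠ 0 ∧ v (algebraMap K K' p.2) = v (aeval x p.1)
  let R : L[X] × K → Subring L[X] := fun p =>
    (eval₂RingHom (lowDegreeRing v x q).subtype (scaled p.2 p.1)).range
  have hgood : ∀ ψ : L[X], ψ.Monic → ψ.natDegree = q → ∃ e : K, Good (ψ, e) := by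
    intro ψ hψ hψq
    obtain ⟨e, he, hev⟩ := exists_ne_zero_value_eq hval (hN ψ hψ.ne_zero (hψq ▸ hqN))
    exact ⟨e, hψ, hψq, he, hev⟩
  have hlow : ∀ p, lowDegreeRing v x q ≤ R p := fun p g hg =>
    ⟨C ⟨g, hg⟩, by simp⟩
  have hX : ∃ p, Good p := by
    obtain ⟨e, he⟩ := hgood (X ^ q) (monic_X_pow q) (natDegree_X_pow q)
    exact ⟨_, he⟩
  -- `Ev f` says that `f` lies in `R p'` for all good `p'` of small enough value at `x`. It is
  -- stable under ring operations because values are totally ordered, so generators suffice.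
  let Ev : L[X] → Prop := fun f => ∃ p, Good p ∧
    ∀ p', Good p' → v (aeval x p'.1) ≤ v (aeval x p.1) → f ∈ R p'
  have hEv₂ : ∀ {f g h : L[X]}, (∀ p, f ∈ R p → g ∈ R p → h ∈ R p) → Ev f → Ev g → Ev h := by
    rintro f g h H ⟨p, hp, hpf⟩ ⟨r, hr, hrg⟩
    rcases le_total (v (aeval x p.1)) (v (aeval x r.1)) with hle | hle
    · exact ⟨p, hp, fun p' hp' hle' => H _ (hpf p' hp' hle') (hrg p' hp' (hle'.trans hle))⟩
    · exact ⟨r, hr, fun p' hp' hle' => H _ (hpf p' hp' (hle'.trans hle)) (hrg p' hp' hle')⟩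
  have hall : ∀ f ∈ lowDegreeRing v x (q + 1), Ev f := by
    intro f hf
    refine Subring.closure_induction (p := fun f _ => Ev f) ?_ ?_ ?_ ?_ ?_ ?_ hf
    · rintro g ⟨hg, hgv⟩
      by_cases hgq : g.degree < q
      · obtain ⟨p, hp⟩ := hX
        exact ⟨p, hp, fun p' _ _ => hlow _ (mem_lowDegreeRing hgq hgv)⟩
      · have hg0 : g ≠ 0 := by rintro rfl; simp at hgq
        have hnat : g.natDegree = q := by
          have h1 := (natDegree_lt_iff_degree_lt hg0).2 hg
          have h2 := mt (natDegree_lt_iff_degree_lt hg0).1 hgq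
          omega
        have hgdeg : g.degree = q := by rw [degree_eq_natDegree hg0, hnat]
        set a := g.leadingCoeff with ha
        have ha0 : a ≠ 0 := leadingCoeff_ne_zero.2 hg0
        have hmon : (C a⁻¹ * g).Monic := by
          rw [Monic, leadingCoeff_mul, leadingCoeff_C, ← ha, inv_mul_cancel₀ ha0]
        have hnat' : (C a⁻¹ * g).natDegree = q := by
          rw [natDegree_C_mul (inv_ne_zero ha0), hnat]
        obtain ⟨e, he⟩ := hgood _ hmon hnat'
        refine ⟨_, he, ?_⟩
        rintro ⟨ψ, e'⟩ ⟨hψ, hψq, he', hev'⟩ hle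
        dsimp only at hψ hψq he' hev' hle
        -- The value of `ψ(x)` is at most that of `g(x) / a`, so `a ψ` is integral at `x`. Then `g`
        -- is `(a e') * (ψ / e')` plus an integral remainder of degree less than `q`.
        have hva : v (aeval x (C a * ψ)) ≤ 1 := by
          rw [map_mul, aeval_C] at hle ⊢
          rw [map_mul]
          refine le_trans (mul_le_mul_right hle _) ?_
          rw [← map_mul, ← mul_assoc, ← map_mul, mul_inv_cancel₀ ha0, map_one, one_mul]
          exact hgv
        have h1 : C a * ψ ∈ R (ψ, e') := by
          have h2 : C (a * algebraMap K L e') ∈ lowDegreeRing v x q := by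
            refine mem_lowDegreeRing (lt_of_le_of_lt degree_C_le (by exact_mod_cast hq)) ?_
            rw [aeval_C, map_mul, map_mul, ← IsScalarTower.algebraMap_apply, hev', ← map_mul]
            rwa [map_mul, aeval_C] at hva
          refine ⟨C ⟨_, h2⟩ * X, ?_⟩
          rw [coe_eval₂RingHom, eval₂_mul, eval₂_C, eval₂_X]
          change C (a * algebraMap K L e') * scaled e' ψ = _
          rw [C_mul, mul_assoc, C_mul_scaled he']
        have h2 : g - C a * ψ ∈ R (ψ, e') := by
          refine hlow _ (mem_lowDegreeRing ?_ ?_)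
          · rw [← hgdeg]
            refine degree_sub_lt_left ?_ hg0 ?_
            · rw [degree_C_mul ha0, degree_eq_natDegree hψ.ne_zero, hψq, hgdeg]
            · rw [leadingCoeff_mul, leadingCoeff_C, hψ.leadingCoeff, mul_one]
          · rw [map_sub]
            exact v.map_sub_le hgv hva
        have := (R (ψ, e')).add_mem h2 h1
        rwa [sub_add_cancel] at this
    · obtain ⟨p, hp⟩ := hX
      exact ⟨p, hp, fun p' _ _ => zero_mem _⟩
    · obtain ⟨p, hp⟩ := hX
      exact ⟨p, hp, fun p' _ _ => one_mem _⟩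
    · intro f g _ _ hf hg
      exact hEv₂ (fun p => add_mem) hf hg
    · intro f _ hf
      exact hEv₂ (fun p h _ => neg_mem h) hf hf
    · intro f g _ _ hf hg
      exact hEv₂ (fun p => mul_mem) hf hg
  have hfin : ∀ G : Finset L[X], (∀ f ∈ G, f ∈ lowDegreeRing v x (q + 1)) → ∃ p, Good p ∧
      ∀ p', Good p' → v (aeval x p'.1) ≤ v (aeval x p.1) → ∀ f ∈ G, f ∈ R p' := by
    intro G
    induction G using Finset.induction_on with
    | empty =>
      obtain ⟨p, hp⟩ := hX
      exact fun _ => ⟨p, hp, by simp⟩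
    | insert f G _ ih =>
      intro hG
      obtain ⟨p, hp, hpG⟩ := ih fun g hg => hG g (Finset.mem_insert_of_mem hg)
      obtain ⟨r, hr, hrf⟩ := hall f (hG f (Finset.mem_insert_self _ _))
      have key : ∀ p', f ∈ R p' → (∀ g ∈ G, g ∈ R p') → ∀ g ∈ insert f G, g ∈ R p' := by
        intro p' h1 h2 g hg
        rcases Finset.mem_insert.1 hg with rfl | hg
        exacts [h1, h2 g hg]
      rcases le_total (v (aeval x p.1)) (v (aeval x r.1)) with hle | hle
      · exact ⟨p, hp, fun p' hp' hle' =>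
          key _ (hrf p' hp' (hle'.trans hle)) (hpG p' hp' hle')⟩
      · exact ⟨r, hr, fun p' hp' hle' =>
          key _ (hrf p' hp' hle') (hpG p' hp' (hle'.trans hle))⟩
  obtain ⟨g, hg, hgq⟩ := SetLike.exists_of_lt
    (lt_of_le_of_ne (lowDegreeRing_mono (Nat.le_succ q)) (Ne.symm hjump))
  -- Capturing also an element `g` outside level `q` forces `ψ / e` outside level `q`.
  obtain ⟨⟨ψ, e⟩, hp, hpF⟩ := hfin (insert g F) (by
    intro f hf
    rcases Finset.mem_insert.1 hf with rfl | hf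
    exacts [hg, hF f hf])
  have hR := hpF _ hp le_rfl
  obtain ⟨hψ, hψq, he, hev⟩ := hp
  refine ⟨ψ, e, hψ, hψq, he, (aeval_scaled_eq_one he hev).le, fun hmem => hgq ?_,
    fun f hf => hR f (Finset.mem_insert_of_mem hf)⟩
  obtain ⟨P, hP⟩ := hR g (Finset.mem_insert_self _ _)
  rw [← hP, coe_eval₂RingHom, eval₂_eq_sum]
  exact sum_mem fun n _ => mul_mem (Subtype.mem _) (pow_mem hmem n)

end Valued

/-! ### Subrings of fractions -/

section Fractions

variable {V T E : Type*} [CommRing V] [CommRing T] [Algebra V T] [CommRing E] [Algebra V E]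

/-- The elements of `E` that are fractions of elements of the image of `θ` with denominator coming
from `S`. -/
def fracSubring (θ : T →ₐ[V] E) (S : Submonoid T) : Subring E where
  carrier := {f | ∃ s ∈ S, ∃ t, θ s * f = θ t}
  mul_mem' := by
    rintro f g ⟨s, hs, t, ht⟩ ⟨s', hs', t', ht'⟩
    refine ⟨s * s', S.mul_mem hs hs', t * t', ?_⟩
    rw [map_mul, map_mul, ← ht, ← ht']; ring
  one_mem' := ⟨1, S.one_mem, 1, by simp⟩
  add_mem' := by
    rintro f g ⟨s, hs, t, ht⟩ ⟨s', hs', t', ht'⟩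
    refine ⟨s * s', S.mul_mem hs hs', s' * t + s * t', ?_⟩
    rw [map_mul, map_add, map_mul, map_mul, ← ht, ← ht']; ring
  zero_mem' := ⟨1, S.one_mem, 0, by simp⟩
  neg_mem' := by
    rintro f ⟨s, hs, t, ht⟩
    exact ⟨s, hs, -t, by rw [map_neg, ← ht]; ring⟩

theorem map_mem_fracSubring (θ : T →ₐ[V] E) (S : Submonoid T) (t : T) : θ t ∈ fracSubring θ S :=
  ⟨1, S.one_mem, t, by simp⟩

theorem mem_fracSubring_of_mul_mem {θ : T →ₐ[V] E} {S : Submonoid T} {s : T} (hs : s ∈ S) {f : E}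
    (h : θ s * f ∈ fracSubring θ S) : f ∈ fracSubring θ S := by
  obtain ⟨s', hs', t, ht⟩ := h
  exact ⟨s' * s, S.mul_mem hs' hs, t, by rw [map_mul, mul_assoc, ht]⟩

theorem fracSubring_mono {T' E' : Type*} [CommRing T'] [Algebra V T'] [CommRing E'] [Algebra V E']
    {θ : T →ₐ[V] E} {S : Submonoid T} {θ' : T' →ₐ[V] E'} {S' : Submonoid T'} (f : T →ₐ[V] T')
    (g : E →ₐ[V] E') (hS : ∀ s ∈ S, f s ∈ S') (hθ : ∀ t, θ' (f t) = g (θ t)) {y : E}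
    (hy : y ∈ fracSubring θ S) : g y ∈ fracSubring θ' S' := by
  obtain ⟨s, hs, t, ht⟩ := hy
  exact ⟨f s, hS s hs, f t, by rw [hθ, hθ, ← map_mul, ht]⟩

theorem exists_common_denominator {θ : T →ₐ[V] E} {S : Submonoid T} (F : Finset E)
    (hF : ∀ f ∈ F, f ∈ fracSubring θ S) : ∃ s ∈ S, ∀ f ∈ F, ∃ t, θ s * f = θ t := by
  classical
  induction F using Finset.induction_on with
  | empty => exact ⟨1, S.one_mem, by simp⟩
  | insert f F _ ih =>
    obtain ⟨s, hs, hsF⟩ := ih fun g hg => hF g (Finset.mem_insert_of_mem hg)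
    obtain ⟨s', hs', t', ht'⟩ := hF f (Finset.mem_insert_self _ _)
    refine ⟨s * s', S.mul_mem hs hs', fun g hg => ?_⟩
    rcases Finset.mem_insert.1 hg with rfl | hg
    · exact ⟨s * t', by rw [map_mul, map_mul, mul_assoc, ht']⟩
    · obtain ⟨t, ht⟩ := hsF g hg
      exact ⟨s' * t, by rw [map_mul, map_mul, mul_comm (θ s), mul_assoc, ht]⟩

/-- The polynomials with coefficients in a subring. -/
def coeffSubring {L : Type*} [CommRing L] (B : Subring L) : Subring L[X] where
  carrier := {f | ∀ n, f.coeff n ∈ B}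
  mul_mem' := by
    intro f g hf hg n
    rw [coeff_mul]
    exact sum_mem fun p _ => mul_mem (hf _) (hg _)
  one_mem' := by
    intro n
    rw [coeff_one]
    split_ifs
    exacts [one_mem _, zero_mem _]
  add_mem' := by
    intro f g hf hg n
    rw [coeff_add]
    exact add_mem (hf n) (hg n)
  zero_mem' := by
    intro n
    rw [coeff_zero]
    exact zero_mem _
  neg_mem' := by
    intro f hf n
    rw [coeff_neg]
    exact neg_mem (hf n)

theorem C_mem_coeffSubring {L : Type*} [CommRing L] {B : Subring L} {a : L} (ha : a ∈ B) :
    C a ∈ coeffSubring B := by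
  intro n
  rw [coeff_C]
  split_ifs
  exacts [ha, zero_mem _]

theorem X_mem_coeffSubring {L : Type*} [CommRing L] {B : Subring L} :
    (X : L[X]) ∈ coeffSubring B := by
  intro n
  rw [coeff_X]
  split_ifs
  exacts [one_mem _, zero_mem _]

theorem eval₂_mem_subring {A E : Type*} [CommRing A] [CommRing E] {B : Subring E} {f : A →+* E}
    (hf : ∀ a, f a ∈ B) {y : E} (hy : y ∈ B) (p : A[X]) : eval₂ f y p ∈ B := by
  rw [eval₂_eq_sum]
  exact sum_mem fun n _ => mul_mem (hf _) (pow_mem hy n)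

end Fractions

/-! ### Stages: one new variable for each key polynomial -/

/-- `v` is a valuation on an extension of the fraction field `K` of `V` with the same values as on
`K`, whose valuation ring dominates `V`. -/
structure IsValueExtension (V K : Type*) {K' Γ : Type*} [CommRing V] [IsLocalRing V] [Field K]
    [Algebra V K] [Field K'] [Algebra K K'] [Algebra V K'] [LinearOrderedCommGroupWithZero Γ]
    (v : Valuation K' Γ) : Prop where
  exists_eq : ∀ y : K', y ≠ 0 → ∃ c : K, v (algebraMap K K' c) = v y
  mem_range : ∀ c : K, v (algebraMap K K' c) ≤ 1 → c ∈ (algebraMap V K).range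
  mem_maximalIdeal : ∀ c : V, v (algebraMap V K' c) < 1 → c ∈ IsLocalRing.maximalIdeal V

section Stage

variable {V : Type u} {K L K' Γ : Type*} [CommRing V] [IsDomain V] [IsLocalRing V]
  [Field K] [Algebra V K] [IsFractionRing V K] [Field L] [Algebra K L] [Algebra V L]
  [IsScalarTower V K L] [Field K'] [Algebra L K'] [Algebra K K'] [Algebra V K']
  [IsScalarTower K L K'] [IsScalarTower V L K'] [IsScalarTower V K K']
  [LinearOrderedCommGroupWithZero Γ]

/-- Evaluation of polynomials at `x`, as a `V`-algebra map. -/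
noncomputable def evalHom (V : Type*) {L K' : Type*} [CommRing V] [Field L] [Algebra V L] [Field K']
    [Algebra L K'] [Algebra V K'] [IsScalarTower V L K'] (x : K') : L[X] →ₐ[V] K' :=
  (aeval x : L[X] →ₐ[L] K').restrictScalars V

omit [IsDomain V] [IsLocalRing V] in
theorem evalHom_apply (x : K') (g : L[X]) : evalHom V x g = aeval x g := rfl

variable {v : Valuation K' Γ}

omit [IsLocalRing V] [Algebra K K'] [IsScalarTower V K K'] in
theorem algebraMap_mem_fracSubring {T E : Type*} [CommRing T] [Algebra V T] [CommRing E]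
    [Algebra V E] [Algebra K E] [IsScalarTower V K E] {π : E →ₐ[V] K'} {θ : T →ₐ[V] E} (k : K) :
    algebraMap K E k ∈ fracSubring θ (denoms v (π.comp θ)) := by
  obtain ⟨a, b, hb, rfl⟩ := IsFractionRing.div_surjective (A := V) k
  have hb0 := nonZeroDivisors.ne_zero hb
  refine ⟨algebraMap V T b, algebraMap_mem_denoms _ _ hb0, algebraMap V T a, ?_⟩
  rw [AlgHom.commutes, AlgHom.commutes, IsScalarTower.algebraMap_apply V K E,
    IsScalarTower.algebraMap_apply V K E, ← map_mul, mul_div_cancel₀]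
  exact (FaithfulSMul.algebraMap_eq_zero_iff V K).not.2 hb0

/-- The data, over a presentation `θ₀` of a subring of `L`, of a presentation of a ring of
polynomials in which the last variable `z` does not enter the relations on the closed fibre. -/
structure IsStage {T₀ T : Type*} [CommRing T₀] [Algebra V T₀] [CommRing T] [Algebra V T]
    (v : Valuation K' Γ) (x : K') (θ₀ : T₀ →ₐ[V] L) (z : L[X]) (ι : T₀ →ₐ[V] T)
    (θ : T[X] →ₐ[V] L[X]) (j' : List T) (j : List T[X]) : Prop where
  pres : IsPresentation v (evalHom V x) θ j
  map_X : θ X = z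
  map_C : ∀ t, θ (C (ι t)) = C (θ₀ t)
  congr : List.Forall₂ (fun f g => f - g ∈ (IsLocalRing.maximalIdeal V).map (algebraMap V T[X])) j
    (j'.map C)
  coeff_mem : ∀ t, θ t ∈
    coeffSubring (fracSubring θ₀ (denoms v ((IsScalarTower.toAlgHom V L K').comp θ₀)))
  X_mem : X ∈ fracSubring θ (denoms v ((evalHom V x).comp θ))

omit [IsDomain V] [Algebra K L] [IsScalarTower V K L] [IsScalarTower K L K'] in
-- Some `p / q` in `K` has the value of `a`, so `q a` has the value of `p ∈ V`.
theorem IsValueExtension.exists_mul_le_one (hv : IsValueExtension V K v)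
    (hV : ∀ c : V, v (algebraMap V K' c) ≤ 1) (a : L) :
    ∃ c : V, c ≠ 0 ∧ v (algebraMap L K' (algebraMap V L c * a)) ≤ 1 := by
  by_cases ha : a = 0
  · exact ⟨1, one_ne_zero, by simp [ha]⟩
  obtain ⟨k, hk⟩ := hv.exists_eq (algebraMap L K' a) ((_root_.map_ne_zero _).2 ha)
  obtain ⟨p, q, hq, rfl⟩ := IsFractionRing.div_surjective (A := V) k
  have hq0 := nonZeroDivisors.ne_zero hq
  refine ⟨q, hq0, ?_⟩
  rw [map_mul, map_mul, ← hk, ← IsScalarTower.algebraMap_apply, ← map_mul,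
    IsScalarTower.algebraMap_apply V K K', ← map_mul, mul_div_cancel₀,
    ← IsScalarTower.algebraMap_apply]
  · exact hV p
  · exact (FaithfulSMul.algebraMap_eq_zero_iff V K).not.2 hq0

omit [Algebra K K'] [IsScalarTower K L K'] [IsScalarTower V K K'] in
/-- The first stage: a normalized polynomial of degree one is a new variable. -/
theorem isStage_one {T₀ : Type*} [CommRing T₀] [Algebra V T₀] {x : K'} {θ₀ : T₀ →ₐ[V] L}
    {j₀ : List T₀} (h : IsPresentation v (IsScalarTower.toAlgHom V L K') θ₀ j₀) {a : L} {e : K}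
    (he : e ≠ 0) (hz : v (aeval x (scaled e (X + C a))) ≤ 1)
    (ha : a ∈ fracSubring θ₀ (denoms v ((IsScalarTower.toAlgHom V L K').comp θ₀))) :
    IsStage v x θ₀ (scaled e (X + C a)) (AlgHom.id V T₀)
      (extendHom ((CAlgHom (R := V) (A := L)).comp θ₀) (scaled e (X + C a))) j₀ (j₀.map C) := by
  set z := scaled e (X + C a) with hz'
  set θ := extendHom ((CAlgHom (R := V) (A := L)).comp θ₀) z with hθ
  have hπ : ∀ l : L, evalHom V x (CAlgHom (R := V) l) = IsScalarTower.toAlgHom V L K' l :=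
    fun l => by simp [evalHom_apply]
  have hθC : ∀ t, θ (C t) = C (θ₀ t) := fun t => by simp [hθ]
  have hC : ∀ l ∈ fracSubring θ₀ (denoms v ((IsScalarTower.toAlgHom V L K').comp θ₀)),
      C l ∈ fracSubring θ (denoms v ((evalHom V x).comp θ)) := fun l hl => by
    refine fracSubring_mono (CAlgHom (R := V)) (CAlgHom (R := V)) (fun s hs => ?_) hθC hl
    refine map_mem_denoms _ (fun t => ?_) hs
    change evalHom V x (θ (C t)) = _
    rw [hθC]
    exact hπ _
  refine ⟨?_, by simp [hθ], hθC, ?_, ?_, ?_⟩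
  -- A polynomial of degree one is transcendental over `L`, so no new relation arises.
  · refine h.adjoin_transcendental hπ hz fun p hp n => ?_
    have hdeg : z.natDegree = 1 := by
      rw [hz', scaled, natDegree_C_mul, natDegree_X_add_C]
      exact (_root_.map_ne_zero _).2 (inv_ne_zero he)
    have h1 : (p.map (θ₀ : T₀ →+* L)).comp z = 0 := by
      rw [← hp, Polynomial.comp, eval₂_map]; rfl
    have h2 : p.map (θ₀ : T₀ →+* L) = 0 := by
      rcases comp_eq_zero_iff.1 h1 with h3 | ⟨-, h3⟩
      · exact h3
      · rw [h3, natDegree_C] at hdeg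
        exact absurd hdeg zero_ne_one
    have := congrArg (fun p => coeff p n) h2
    simpa using this
  · rw [List.forall₂_same]
    simp
  · intro t
    rw [hθ, extendHom_apply]
    refine eval₂_mem_subring (fun r => ?_) ?_ t
    · exact C_mem_coeffSubring (map_mem_fracSubring _ _ _)
    · exact mul_mem (C_mem_coeffSubring (algebraMap_mem_fracSubring _))
        (add_mem X_mem_coeffSubring (C_mem_coeffSubring ha))
  · have h1 : (X : L[X]) = C (algebraMap K L e) * z - C a := by
      rw [hz', C_mul_scaled he, add_sub_cancel_right]
    have h2 : z ∈ fracSubring θ (denoms v ((evalHom V x).comp θ)) := by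
      have := map_mem_fracSubring θ (denoms v ((evalHom V x).comp θ)) X
      rwa [hθ, extendHom_X] at this
    rw [h1]
    exact sub_mem (mul_mem (hC _ (algebraMap_mem_fracSubring e)) h2) (hC _ ha)

variable {x : K'} {T₀ T : Type*} [CommRing T₀] [Algebra V T₀] [CommRing T] [Algebra V T]
  {θ₀ : T₀ →ₐ[V] L} {z : L[X]} {ι : T₀ →ₐ[V] T} {θ : T[X] →ₐ[V] L[X]} {j' : List T} {j : List T[X]}

/-- A polynomial with a unit coefficient, evaluated at the last variable of a stage, is regular on
the closed fibre. -/
theorem IsStage.regularAt (h : IsStage v x θ₀ z ι θ j' j) {M : T[X]} {k : ℕ}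
    (hk : v (aeval x (θ (C (M.coeff k)))) = 1) :
    RegularAt (valueOne v ((evalHom V x).comp θ))
      ((IsLocalRing.maximalIdeal V).map (algebraMap V T[X]) ⊔ Ideal.ofList j) M := by
  -- On the closed fibre the earlier relations come from `T`, so McCoy's theorem applies in the last
  -- variable.
  rw [Ideal.sup_ofList_congr h.congr, ← Ideal.map_ofList, Ideal.map_algebraMap_polynomial,
    ← Ideal.map_sup]
  exact regularAt_map_C_of_coeff_mem
    (S := valueOne v ((evalHom V x).comp (θ.comp CAlgHom))) (fun s hs => hs) _ hk

/-- Lifting a polynomial in the last variable of a stage. -/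
theorem IsStage.exists_lift (h : IsStage v x θ₀ z ι θ j' j) (P : L[X][X])
    (hP : ∀ k ∈ P.support, P.coeff k ∈ fracSubring (θ.comp CAlgHom)
      ((valueOne v ((IsScalarTower.toAlgHom V L K').comp θ₀)).map ι)) :
    ∃ b ∈ valueOne v ((IsScalarTower.toAlgHom V L K').comp θ₀), ∃ M : T[X],
      θ M = C (θ₀ b) * P.eval z ∧ ∀ k, θ (C (M.coeff k)) = C (θ₀ b) * P.coeff k := by
  classical
  obtain ⟨_, ⟨b, hb, rfl⟩, hcom⟩ := exists_common_denominator (P.support.image P.coeff) (by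
    intro f hf
    obtain ⟨k, hk, rfl⟩ := Finset.mem_image.1 hf
    exact hP k hk)
  have hex : ∀ k, ∃ t : T, θ (C t) = C (θ₀ b) * P.coeff k := by
    intro k
    by_cases hk : k ∈ P.support
    · obtain ⟨t, ht⟩ := hcom _ (Finset.mem_image_of_mem _ hk)
      refine ⟨t, ?_⟩
      rw [← h.map_C]
      exact ht.symm
    · exact ⟨0, by rw [notMem_support_iff.1 hk]; simp⟩
  choose t ht using hex
  have hcoef : ∀ k, θ (C ((∑ k ∈ P.support, C (t k) * X ^ k).coeff k)) =
      C (θ₀ b) * P.coeff k := by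
    intro k
    rw [finsetSum_coeff]
    simp only [coeff_C_mul, coeff_X_pow, mul_ite, mul_one, mul_zero, Finset.sum_ite_eq]
    split_ifs with hk
    · exact ht k
    · rw [notMem_support_iff.1 hk]; simp
  refine ⟨b, hb, ∑ k ∈ P.support, C (t k) * X ^ k, ?_, hcoef⟩
  rw [map_sum, eval_eq_sum, Polynomial.sum, Finset.mul_sum]
  refine Finset.sum_congr rfl fun k _ => ?_
  rw [map_mul, map_pow, ht, h.map_X, mul_assoc]

/-- The next stage: a new polynomial of small value becomes the last variable. -/
theorem IsStage.next (h : IsStage v x θ₀ z ι θ j' j) {b : T₀}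
    (hb : b ∈ valueOne v ((IsScalarTower.toAlgHom V L K').comp θ₀)) {d : V} (hd0 : d ≠ 0)
    (hd : d ∈ IsLocalRing.maximalIdeal V) {y : L[X]} (hy : v (aeval x y) ≤ 1) {M : T[X]}
    (hM : θ M = C (algebraMap V L d * θ₀ b) * y) {k : ℕ}
    (hk : v (aeval x (θ (C (M.coeff k)))) = 1) :
    IsStage v x θ₀ y ((CAlgHom (R := V)).comp ι) (extendHom θ y) (j ++ [M])
      (j.map C ++ [C M - C (algebraMap V T[X] d * C (ι b)) * X]) := by
  have hb' : C (ι b) ∈ valueOne v ((evalHom V x).comp θ) := by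
    rw [mem_valueOne] at hb ⊢
    rw [AlgHom.comp_apply, h.map_C, evalHom_apply, aeval_C]
    exact hb
  have hreg := h.regularAt hk
  refine ⟨?_, by simp, fun t => ?_, ?_, fun t => ?_, ?_⟩
  · refine h.pres.adjoin_relation hb' hd hd0 hy ?_ hreg
    rw [h.map_C, hM, C_mul]
    rfl
  · rw [AlgHom.comp_apply, CAlgHom_apply, extendHom_C, h.map_C]
  · rw [List.map_append]
    refine List.rel_append (List.forall₂_same.2 fun f _ => by simp) (List.Forall₂.cons ?_ .nil)
    rw [sub_sub_cancel_left, map_mul, Ideal.map_algebraMap_polynomial]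
    exact neg_mem (Ideal.mul_mem_right _ _ (Ideal.mul_mem_right _ _
      (Ideal.mem_map_of_mem _ (Ideal.mem_map_of_mem _ hd))))
  · rw [extendHom_apply]
    refine eval₂_mem_subring (fun r => h.coeff_mem r) (fun n => ?_) t
    refine mem_fracSubring_of_mul_mem
      (S := denoms v ((IsScalarTower.toAlgHom V L K').comp θ₀)) (s := algebraMap V T₀ d * b)
      ⟨d, hd0, b, hb, rfl⟩ ?_
    have := h.coeff_mem M n
    rw [hM, coeff_C_mul] at this
    rwa [map_mul, AlgHom.commutes]
  · refine fracSubring_mono (CAlgHom (R := V)) (AlgHom.id V L[X]) (fun s hs => ?_)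
      (fun t => by simp) h.X_mem
    exact map_mem_denoms _ (fun t => by simp) hs

end Stage

/-! ### Induction over the jumps -/

section Tower

variable {V : Type u} {K L K' Γ : Type*} [CommRing V] [IsDomain V] [IsLocalRing V]
  [Field K] [Algebra V K] [IsFractionRing V K] [Field L] [Algebra K L] [Algebra V L]
  [IsScalarTower V K L] [Field K'] [Algebra L K'] [Algebra K K'] [Algebra V K']
  [IsScalarTower K L K'] [IsScalarTower V L K'] [IsScalarTower V K K']
  [LinearOrderedCommGroupWithZero Γ] {v : Valuation K' Γ} {x : K'}

omit [Algebra K K'] [IsScalarTower K L K'] in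
theorem scaled_mem_lowDegreeRing {e : K} {ψ : L[X]} {q : ℕ} (hψ : ψ.natDegree = q)
    (h : v (aeval x (scaled e ψ)) ≤ 1) : scaled e ψ ∈ lowDegreeRing v x (q + 1) := by
  refine mem_lowDegreeRing ?_ h
  refine lt_of_le_of_lt ((degree_mul_le _ _).trans (add_le_add degree_C_le degree_le_natDegree)) ?_
  rw [hψ, zero_add]
  exact_mod_cast Nat.lt_succ_self q

theorem C_mul_scaled_eq {e μ : K} (he : e ≠ 0) (ψ : L[X]) :
    C (algebraMap K L (e / μ)) * scaled e ψ = scaled μ ψ := by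
  rw [scaled, scaled, ← mul_assoc, ← C_mul, ← map_mul]
  congr 3
  field_simp

omit [IsDomain V] [IsFractionRing V K] [IsScalarTower V L K'] in
/-- A normalized polynomial outside the ring generated in lower degrees is obtained by dividing an
element of that ring by an element of the maximal ideal. -/
theorem exists_mem_maximalIdeal_of_notMem (hv : IsValueExtension V K v) {e μ : K} (he : e ≠ 0)
    (hμ : μ ≠ 0) {ψ : L[X]} {q : ℕ} (hq : 1 ≤ q) (hμψ : scaled μ ψ ∈ lowDegreeRing v x q)
    (hψ : scaled e ψ ∉ lowDegreeRing v x q) :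
    ∃ d ∈ IsLocalRing.maximalIdeal V, d ≠ 0 ∧
      C (algebraMap V L d) * scaled e ψ = scaled μ ψ := by
  have hlt : v (algebraMap K K' (e / μ)) < 1 := by
    by_contra hle
    refine hψ ?_
    rw [← C_mul_scaled_eq (μ := e) hμ]
    refine mul_mem (mem_lowDegreeRing ?_ ?_) hμψ
    · exact lt_of_le_of_lt degree_C_le (by exact_mod_cast hq)
    · rw [aeval_C, ← IsScalarTower.algebraMap_apply, ← inv_div, map_inv₀, map_inv₀]
      exact inv_le_one_of_one_le₀ (not_lt.1 hle)
  obtain ⟨d, hd⟩ := hv.mem_range _ hlt.le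
  refine ⟨d, hv.mem_maximalIdeal d ?_, ?_, ?_⟩
  · rwa [IsScalarTower.algebraMap_apply V K K', hd]
  · rintro rfl
    rw [map_zero] at hd
    exact div_ne_zero he hμ hd.symm
  · rw [IsScalarTower.algebraMap_apply V K L, hd, C_mul_scaled_eq he]

theorem eval_mem_lowDegreeRing {q : ℕ} {P : L[X][X]} (hP : ∀ k, P.coeff k ∈ lowDegreeRing v x q)
    {z : L[X]} (hz : z ∈ lowDegreeRing v x (q + 1)) : P.eval z ∈ lowDegreeRing v x (q + 1) := by
  rw [eval_eq_sum]
  exact sum_mem fun n _ => mul_mem (lowDegreeRing_mono (Nat.le_succ q) (hP n)) (pow_mem hz n)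

/-- Elements of the ring at level `q + 1` written as polynomials in the last variable of a stage
are captured by the stage as soon as their coefficients are. -/
theorem IsStage.mem_fracSubring {T₀ T : Type*} [CommRing T₀] [Algebra V T₀] [CommRing T]
    [Algebra V T] {θ₀ : T₀ →ₐ[V] L} {z : L[X]} {ι : T₀ →ₐ[V] T} {θ : T[X] →ₐ[V] L[X]}
    {j' : List T} {j : List T[X]} (h : IsStage v x θ₀ z ι θ j' j) {P : L[X][X]}
    {S : Submonoid T₀}
    (hP : ∀ k ∈ P.support, P.coeff k ∈ fracSubring (θ.comp CAlgHom) (S.map ι)) :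
    P.eval z ∈ fracSubring θ (S.map ((CAlgHom (R := V)).comp ι)) := by
  rw [eval_eq_sum]
  refine sum_mem fun n hn => mul_mem ?_ (pow_mem ?_ n)
  · refine fracSubring_mono (θ := θ.comp CAlgHom) (S := S.map ι) (θ' := θ) (CAlgHom (R := V))
      (AlgHom.id V L[X]) ?_ (fun t => rfl) (hP n hn)
    rintro _ ⟨s, hs, rfl⟩
    exact ⟨s, hs, rfl⟩
  · rw [← h.map_X]
    exact map_mem_fracSubring _ _ _

/-- Every element in the range of evaluation over a subring is a value of a polynomial with
coefficients there. -/
theorem exists_eval_eq_of_mem_range {A : Type*} [CommRing A] {B : Subring A} {z f : A}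
    (h : f ∈ (eval₂RingHom B.subtype z).range) :
    ∃ P : A[X], (∀ k, P.coeff k ∈ B) ∧ P.eval z = f := by
  obtain ⟨p, rfl⟩ := h
  exact ⟨p.map B.subtype, fun k => by simp, by rw [eval_map]; rfl⟩

/-- Existence of stages over every sufficiently fine presentation. -/
theorem exists_stage (hv : IsValueExtension V K v) (hV : ∀ c : V, v (algebraMap V K' c) ≤ 1)
    (hx : v x ≤ 1) {N : ℕ} (hN : ∀ g : L[X], g ≠ 0 → g.natDegree < N → aeval x g ≠ 0) (q : ℕ)
    (hq : 1 ≤ q) (hqN : q < N) {ψ : L[X]} {e : K} (hψ : ψ.Monic) (hψq : ψ.natDegree = q)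
    (he : e ≠ 0) (hz : v (aeval x (scaled e ψ)) ≤ 1) (hzq : scaled e ψ ∉ lowDegreeRing v x q)
    (F : Finset L[X]) (hF : ∀ f ∈ F, f ∈ lowDegreeRing v x q) :
    ∃ G : Finset L, (∀ y ∈ G, v (algebraMap L K' y) ≤ 1) ∧
      ∀ (T₀ : Type u) [CommRing T₀] [Algebra V T₀] (θ₀ : T₀ →ₐ[V] L) (j₀ : List T₀),
        IsFinitePolynomialAlgebra V T₀ →
        IsPresentation v (IsScalarTower.toAlgHom V L K') θ₀ j₀ →
        (∀ y ∈ G, y ∈ fracSubring θ₀ (valueOne v ((IsScalarTower.toAlgHom V L K').comp θ₀))) →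
        ∃ (T : Type u) (_ : CommRing T) (_ : Algebra V T) (ι : T₀ →ₐ[V] T)
          (θ : T[X] →ₐ[V] L[X]) (j' : List T) (j : List T[X]),
          IsFinitePolynomialAlgebra V T ∧ IsStage v x θ₀ (scaled e ψ) ι θ j' j ∧
          ∀ f ∈ F, f ∈ fracSubring (θ.comp CAlgHom)
            ((valueOne v ((IsScalarTower.toAlgHom V L K').comp θ₀)).map ι) := by
  classical
  induction q using Nat.strong_induction_on generalizing ψ e F with
  | _ q ih =>
    by_cases hq1 : q = 1
    · subst hq1
      have hψX : ψ = X + C (ψ.coeff 0) := by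
        conv_lhs => rw [eq_X_add_C_of_natDegree_le_one hψq.le]
        rw [← hψq, hψ.coeff_natDegree, C_1, one_mul]
      -- At level one all elements of `F` are constants, and the variable is `X + a` up to scaling;
      -- `c` makes `a` integral so that it can be captured by the base presentation.
      obtain ⟨c, hc, hca⟩ := hv.exists_mul_le_one hV (ψ.coeff 0)
      refine ⟨insert (algebraMap V L c * ψ.coeff 0) (F.image fun f => f.coeff 0), ?_, ?_⟩
      · intro y hy
        rcases Finset.mem_insert.1 hy with rfl | hy
        · exact hca
        · obtain ⟨f, hf, rfl⟩ := Finset.mem_image.1 hy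
          obtain ⟨a, ha, rfl⟩ := exists_C_of_mem_lowDegreeRing_one (hF f hf)
          simpa using ha
      · intro T₀ _ _ θ₀ j₀ hT₀ h₀ hG
        have ha : ψ.coeff 0 ∈
            fracSubring θ₀ (denoms v ((IsScalarTower.toAlgHom V L K').comp θ₀)) := by
          refine mem_fracSubring_of_mul_mem (algebraMap_mem_denoms _ _ hc) ?_
          rw [AlgHom.commutes]
          exact fracSubring_mono (AlgHom.id V T₀) (AlgHom.id V L)
            (fun s hs => valueOne_le_denoms _ _ hs) (fun _ => rfl)
            (hG _ (Finset.mem_insert_self _ _))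
        rw [hψX] at hz ⊢
        refine ⟨T₀, inferInstance, inferInstance, _, _, _, _, hT₀, isStage_one h₀ he hz ha, ?_⟩
        intro f hf
        obtain ⟨a, -, rfl⟩ := exists_C_of_mem_lowDegreeRing_one (hF f hf)
        have haG := hG a (Finset.mem_insert_of_mem (Finset.mem_image.2 ⟨C a, hf, by simp⟩))
        refine fracSubring_mono (AlgHom.id V T₀) (CAlgHom (R := V) (A := L)) ?_
          (fun t => by simp) haG
        exact fun s hs => ⟨s, hs, rfl⟩
    -- Level `q` equals level `q' + 1` for the last jump `q' < q`; degrees between them add nothing.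
    · obtain ⟨q', hq'1, hq'q, hjump, hAq⟩ := exists_jump (L := L) hx (s := q) (by omega)
      rw [hAq] at hzq hF
      obtain ⟨ψ', e', hψ', hψq', he', hz', hzq', hrep⟩ :=
        exists_normal_form hv.exists_eq hN hq'1 (hq'q.trans hqN) hjump F hF
      obtain ⟨μ, P, hμ, hPA, ⟨k, hk⟩, hPψ⟩ := exists_normalized_expansion hv.exists_eq hN hq'1
        (hq'q.trans hqN) hψ' hψq' he' hψ.ne_zero
      have hμψ : scaled μ ψ ∈ lowDegreeRing v x (q' + 1) := by
        rw [← hPψ]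
        exact eval_mem_lowDegreeRing hPA (scaled_mem_lowDegreeRing hψq' hz')
      obtain ⟨d, hd, hd0, hdψ⟩ :=
        exists_mem_maximalIdeal_of_notMem hv he hμ (Nat.succ_pos q') hμψ hzq
      choose! R hRA hR using fun f hf => exists_eval_eq_of_mem_range (hrep f hf)
      -- The previous stage must capture the coefficients of the new relation and those of the
      -- elements of `F`; all of them lie in level `q'`.
      set F' : Finset L[X] := P.support.image P.coeff ∪
        F.biUnion (fun f => (R f).support.image (R f).coeff) with hF'
      obtain ⟨G, hG1, hG⟩ := ih q' hq'q hq'1 (hq'q.trans hqN) hψ' hψq' he' hz' hzq' F' (by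
        intro f hf
        rcases Finset.mem_union.1 hf with hf | hf
        · obtain ⟨k, -, rfl⟩ := Finset.mem_image.1 hf
          exact hPA k
        · obtain ⟨g, hg, hf⟩ := Finset.mem_biUnion.1 hf
          obtain ⟨k, -, rfl⟩ := Finset.mem_image.1 hf
          exact hRA g hg k)
      refine ⟨G, hG1, fun T₀ _ _ θ₀ j₀ hT₀ h₀ hGT => ?_⟩
      obtain ⟨T, _, _, ι, θ, j', j, hT, hst, hcap⟩ := hG T₀ θ₀ j₀ hT₀ h₀ hGT
      obtain ⟨b, hb, M, hM, hMk⟩ := hst.exists_lift P fun k hk =>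
        hcap _ (Finset.mem_union_left _ (Finset.mem_image_of_mem _ hk))
      have hst' := hst.next hb hd0 hd hz (M := M) (k := k) (by
        rw [hM, hPψ, ← hdψ, C_mul]; ring) (by
        rw [hMk, map_mul, map_mul, aeval_C, hk, mul_one]
        exact hb)
      refine ⟨T[X], inferInstance, inferInstance, _, _, _, _, hT.polynomial, hst', ?_⟩
      intro f hf
      have hcomp : (extendHom θ (scaled e ψ)).comp CAlgHom = θ := AlgHom.ext fun t => by simp
      rw [hcomp, ← hR f hf]
      exact hst.mem_fracSubring fun k hk => hcap _ (Finset.mem_union_right _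
        (Finset.mem_biUnion.2 ⟨f, hf, Finset.mem_image_of_mem _ hk⟩))

end Tower

/-! ### Passage from `L` to `L(x)` -/

section Division

/-- Division by a monic polynomial stays within the coefficient ring, even though divisibility is
only given over `L`. -/
theorem dvd_coeffSubring {L : Type*} [CommRing L] {B : Subring L} {f g : L[X]} (hf : f.Monic)
    (hfB : f ∈ coeffSubring B) (hgB : g ∈ coeffSubring B) (h : f ∣ g) :
    ∃ r ∈ coeffSubring B, g = f * r := by
  have hsub : ∀ {p : L[X]}, p ∈ coeffSubring B → (↑p.coeffs : Set L) ⊆ B := by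
    intro p hp a ha
    obtain ⟨n, -, rfl⟩ := mem_coeffs_iff.1 ha
    exact hp n
  have hf' : (f.toSubring B (hsub hfB)).map B.subtype = f := map_toSubring ..
  have hg' : (g.toSubring B (hsub hgB)).map B.subtype = g := map_toSubring ..
  have hmon := (monic_toSubring f B (hsub hfB)).2 hf
  rw [← hf', ← hg', map_dvd_map _ B.subtype_injective hmon] at h
  obtain ⟨r, hr⟩ := h
  refine ⟨r.map B.subtype, fun n => by simp, ?_⟩
  conv_lhs => rw [← hg', hr, Polynomial.map_mul, hf']

end Division

section Tower

variable {V : Type u} {K L K' Γ : Type*} [CommRing V] [IsDomain V] [IsLocalRing V]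
  [Field K] [Algebra V K] [IsFractionRing V K] [Field L] [Algebra K L] [Algebra V L]
  [IsScalarTower V K L] [Field K'] [Algebra L K'] [Algebra K K'] [Algebra V K']
  [IsScalarTower K L K'] [IsScalarTower V L K'] [IsScalarTower V K K']
  [LinearOrderedCommGroupWithZero Γ] {v : Valuation K' Γ} {x : K'}

omit [Algebra K K'] [IsScalarTower K L K'] [IsScalarTower V K K'] in
/-- If the minimal polynomial of `x` lifts, up to units and constants, to a polynomial in the last
variable of a stage, then it generates the kernel of evaluation at `x`, up to denominators. -/
theorem IsStage.exists_mul_eq_of_aeval_eq_zero {T₀ T : Type*} [CommRing T₀] [Algebra V T₀]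
    [CommRing T] [Algebra V T] {θ₀ : T₀ →ₐ[V] L} {z : L[X]} {ι : T₀ →ₐ[V] T}
    {θ : T[X] →ₐ[V] L[X]} {j' : List T} {j : List T[X]} (h : IsStage v x θ₀ z ι θ j' j)
    (hx : IsIntegral L x) {b : T₀}
    (hb : b ∈ valueOne v ((IsScalarTower.toAlgHom V L K').comp θ₀)) {μ : K} (hμ : μ ≠ 0) {M : T[X]}
    (hM : θ M = C (θ₀ b) * scaled μ (minpoly L x)) (t : T[X]) (ht : evalHom V x (θ t) = 0) :
    ∃ s ∈ denoms v ((evalHom V x).comp θ), ∃ r, θ (s * t) = θ (M * r) := by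
  set B := fracSubring θ₀ (denoms v ((IsScalarTower.toAlgHom V L K').comp θ₀)) with hB
  set D := fracSubring θ (denoms v ((evalHom V x).comp θ)) with hD
  have hφB : minpoly L x ∈ coeffSubring B := by
    rw [← C_mul_scaled hμ (minpoly L x)]
    refine mul_mem (C_mem_coeffSubring (algebraMap_mem_fracSubring μ)) fun n => ?_
    refine mem_fracSubring_of_mul_mem (valueOne_le_denoms _ _ hb) ?_
    have := h.coeff_mem M n
    rwa [hM, coeff_C_mul] at this
  obtain ⟨g, hg, hgt⟩ := dvd_coeffSubring (minpoly.monic hx) hφB (h.coeff_mem t)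
    (minpoly.dvd L x ht)
  have hCB : ∀ a ∈ B, C a ∈ D := fun a ha => by
    refine fracSubring_mono ((CAlgHom (R := V)).comp ι) (CAlgHom (R := V) (A := L)) (fun s hs => ?_)
      (fun t => h.map_C t) ha
    refine map_mem_denoms _ (fun t => ?_) hs
    rw [AlgHom.comp_apply, AlgHom.comp_apply, CAlgHom_apply, h.map_C, evalHom_apply, aeval_C]
    rfl
  -- The cofactor `g` has coefficients that are fractions of the base, and `X` is a fraction in the
  -- stage. The factor `μ` compensates for the normalization of the minimal polynomial in `M`.
  have hgD : C (algebraMap K L μ) * g ∈ D := by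
    refine mul_mem (hCB _ (algebraMap_mem_fracSubring μ)) ?_
    rw [← g.eval₂_C_X, eval₂_eq_sum]
    exact sum_mem fun n _ => mul_mem (hCB _ (hg n)) (pow_mem h.X_mem n)
  obtain ⟨s, hs, r, hr⟩ := hgD
  refine ⟨s * C (ι b), mul_mem hs (valueOne_le_denoms _ _ ?_), r, ?_⟩
  · rw [mem_valueOne] at hb ⊢
    rw [AlgHom.comp_apply, h.map_C, evalHom_apply, aeval_C]
    exact hb
  · rw [map_mul, map_mul, map_mul, ← hr, hM, h.map_C, hgt]
    conv_lhs => rw [← C_mul_scaled hμ (minpoly L x)]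
    ring

/-- Every finite set of elements of `L` of value at most one is captured by a presentation. -/
def HasPresentations (V L : Type*) {K' Γ : Type*} [CommRing V] [IsDomain V] [IsLocalRing V]
    [Field L] [Algebra V L] [Field K'] [Algebra L K'] [Algebra V K'] [IsScalarTower V L K']
    [LinearOrderedCommGroupWithZero Γ] (v : Valuation K' Γ) : Prop :=
  ∀ F : Finset L, (∀ y ∈ F, v (algebraMap L K' y) ≤ 1) →
    ∃ (n : ℕ) (θ : MvPolynomial (Fin n) V →ₐ[V] L) (j : List (MvPolynomial (Fin n) V)),
      IsPresentation v (IsScalarTower.toAlgHom V L K') θ j ∧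
      ∀ y ∈ F, y ∈ fracSubring θ (valueOne v ((IsScalarTower.toAlgHom V L K').comp θ))

/-- A stage capturing finitely many integral polynomials of small degree. -/
theorem HasPresentations.exists_stage (hL : HasPresentations V L v) (hv : IsValueExtension V K v)
    (hV : ∀ c : V, v (algebraMap V K' c) ≤ 1) (hx : v x ≤ 1) {N : ℕ} (hN2 : 2 ≤ N)
    (hN : ∀ g : L[X], g ≠ 0 → g.natDegree < N → aeval x g ≠ 0) (F : Finset L[X])
    (hF : ∀ f ∈ F, f ∈ lowDegreeRing v x N) {φ : L[X]} (hφ : φ ≠ 0) :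
    ∃ (n : ℕ) (θ₀ : MvPolynomial (Fin n) V →ₐ[V] L) (T : Type u) (_ : CommRing T)
      (_ : Algebra V T) (z : L[X]) (ι : MvPolynomial (Fin n) V →ₐ[V] T) (θ : T[X] →ₐ[V] L[X])
      (j' : List T) (j : List T[X]), IsFinitePolynomialAlgebra V T ∧ IsStage v x θ₀ z ι θ j' j ∧
      (∀ f ∈ F, f ∈ fracSubring θ (valueOne v ((evalHom V x).comp θ))) ∧
      ∃ b ∈ valueOne v ((IsScalarTower.toAlgHom V L K').comp θ₀), ∃ (μ : K) (M : T[X]) (k : ℕ),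
        μ ≠ 0 ∧ θ M = C (θ₀ b) * scaled μ φ ∧ v (aeval x (θ (C (M.coeff k)))) = 1 := by
  classical
  obtain ⟨q, hq1, hqN, hjump, hAq⟩ := exists_jump (L := L) hx hN2
  rw [hAq] at hF
  obtain ⟨ψ, e, hψ, hψq, he, hz, hzq, hrep⟩ :=
    exists_normal_form hv.exists_eq hN hq1 hqN hjump F hF
  obtain ⟨μ, P, hμ, hPA, ⟨k, hk⟩, hPφ⟩ := exists_normalized_expansion hv.exists_eq hN hq1 hqN hψ
    hψq he hφ
  choose! R hRA hR using fun f hf => exists_eval_eq_of_mem_range (hrep f hf)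
  obtain ⟨G, hG1, hG⟩ := _root_.exists_stage hv hV hx hN q hq1 hqN hψ hψq he hz hzq
    (P.support.image P.coeff ∪ F.biUnion (fun f => (R f).support.image (R f).coeff)) (by
      intro f hf
      rcases Finset.mem_union.1 hf with hf | hf
      · obtain ⟨k, -, rfl⟩ := Finset.mem_image.1 hf
        exact hPA k
      · obtain ⟨g, hg, hf⟩ := Finset.mem_biUnion.1 hf
        obtain ⟨k, -, rfl⟩ := Finset.mem_image.1 hf
        exact hRA g hg k)
  obtain ⟨n, θ₀, j₀, h₀, hGT⟩ := hL G hG1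
  obtain ⟨T, _, _, ι, θ, j', j, hT, hst, hcap⟩ := hG _ θ₀ j₀ ⟨n, ⟨AlgEquiv.refl⟩⟩ h₀ hGT
  obtain ⟨b, hb, M, hM, hMk⟩ := hst.exists_lift P fun k hk =>
    hcap _ (Finset.mem_union_left _ (Finset.mem_image_of_mem _ hk))
  refine ⟨n, θ₀, T, _, _, _, ι, θ, j', j, hT, hst, fun f hf => ?_, b, hb, μ, M, k, hμ,
    by rw [hM, hPφ], ?_⟩
  · rw [← hR f hf]
    refine fracSubring_mono (AlgHom.id V T[X]) (AlgHom.id V L[X]) ?_ (fun _ => rfl)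
      (hst.mem_fracSubring (P := R f) fun k hk => hcap _ (Finset.mem_union_right _
        (Finset.mem_biUnion.2 ⟨f, hf, Finset.mem_image_of_mem _ hk⟩)))
    rintro _ ⟨s, hs, rfl⟩
    change s ∈ valueOne v _ at hs
    change v (aeval x (θ (C (ι s)))) = 1
    rw [hst.map_C, aeval_C]
    exact hs
  · rw [hMk, map_mul, map_mul, aeval_C, hk, mul_one]
    exact hb

theorem IsPresentation.exists_mvPolynomial {T E : Type*} [CommRing T] [Algebra V T] [CommRing E]
    [Algebra V E] {π : E →ₐ[V] K'} {θ : T →ₐ[V] E} {j : List T} (h : IsPresentation v π θ j)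
    (hT : IsFinitePolynomialAlgebra V T) :
    ∃ (n : ℕ) (θ' : MvPolynomial (Fin n) V →ₐ[V] E) (j' : List (MvPolynomial (Fin n) V)),
      IsPresentation v π θ' j' ∧ (∀ t, θ' t ∈ θ.range) ∧
      ∀ y, y ∈ fracSubring θ (valueOne v (π.comp θ)) →
        y ∈ fracSubring θ' (valueOne v (π.comp θ')) := by
  obtain ⟨n, ⟨e⟩⟩ := hT
  refine ⟨n, _, _, h.comp_equiv e, fun t => ⟨e.symm t, rfl⟩, fun y hy => ?_⟩
  refine fracSubring_mono (e : T →ₐ[V] _) (AlgHom.id V E) (fun s hs => ?_) (fun t => by simp) hy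
  rw [mem_valueOne] at hs ⊢
  simpa using hs

/-- Divide both polynomials by a constant of the value of the denominator; the numerator becomes
integral because `y` is. -/
theorem exists_normalized_fraction
    (hval : ∀ y : K', y ≠ 0 → ∃ c : K, v (algebraMap K K' c) = v y) {N : ℕ} {y : K'} (hy : v y ≤ 1)
    {p q : L[X]} (hp : p.degree < N) (hq : q.degree < N) (hq0 : aeval x q ≠ 0)
    (h : y * aeval x q = aeval x p) : ∃ p' ∈ lowDegreeRing (L := L) v x N,
      ∃ q' ∈ lowDegreeRing (L := L) v x N,
      v (aeval x q') = 1 ∧ y * aeval x q' = aeval x p' := by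
  obtain ⟨c, hc, hcv⟩ := exists_ne_zero_value_eq hval hq0
  have hdeg : ∀ f : L[X], f.degree < N → (scaled c f).degree < N := fun f hf => by
    refine lt_of_le_of_lt ((degree_mul_le _ _).trans (add_le_add degree_C_le le_rfl)) ?_
    rwa [zero_add]
  have h1 := aeval_scaled_eq_one hc hcv
  have h2 : y * aeval x (scaled c q) = aeval x (scaled c p) := by
    rw [aeval_scaled, aeval_scaled, ← h]; ring
  refine ⟨scaled c p, mem_lowDegreeRing (hdeg p hp) ?_, scaled c q,
    mem_lowDegreeRing (hdeg q hq) h1.le, h1, h2⟩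
  rw [← h2, map_mul, h1, mul_one]
  exact hy

omit [IsDomain V] [IsLocalRing V] in
-- The numerator in a fraction representing `q` has value one along with `q(x)`, so it is itself an
-- admissible denominator.
theorem mem_fracSubring_of_mul_eq {T : Type*} [CommRing T] [Algebra V T] {θ : T →ₐ[V] L[X]}
    {p q : L[X]} (hp : p ∈ fracSubring θ (valueOne v ((evalHom V x).comp θ)))
    (hq : q ∈ fracSubring θ (valueOne v ((evalHom V x).comp θ))) (hq1 : v (aeval x q) = 1) {y : K'}
    (h : y * aeval x q = aeval x p) :
    y ∈ fracSubring ((evalHom V x).comp θ) (valueOne v ((evalHom V x).comp θ)) := by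
  obtain ⟨s, hs, t, ht⟩ := hp
  obtain ⟨s', hs', t', ht'⟩ := hq
  have e1 := congrArg (evalHom V x) ht
  have e2 := congrArg (evalHom V x) ht'
  rw [map_mul, evalHom_apply (g := p)] at e1
  rw [map_mul, evalHom_apply (g := q)] at e2
  have ht'1 : t' ∈ valueOne v ((evalHom V x).comp θ) := by
    rw [mem_valueOne] at hs' ⊢
    rw [AlgHom.comp_apply] at hs' ⊢
    rw [← e2, map_mul, hs', hq1, one_mul]
  refine ⟨s * t', mul_mem hs ht'1, s' * t, ?_⟩
  rw [map_mul, map_mul, AlgHom.comp_apply, AlgHom.comp_apply, AlgHom.comp_apply, AlgHom.comp_apply,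
    ← e1, ← e2, ← h]
  ring

/-- The common part of the algebraic and the transcendental case of the passage from `L` to
`L(x)`. -/
theorem HasPresentations.exists_presentation_of_fractions (hL : HasPresentations V L v)
    (hv : IsValueExtension V K v) (hV : ∀ c : V, v (algebraMap V K' c) ≤ 1) (hx : v x ≤ 1) {N : ℕ}
    (hN2 : 2 ≤ N) (hN : ∀ g : L[X], g ≠ 0 → g.natDegree < N → aeval x g ≠ 0)
    (hNx : IsIntegral L x ∨ Transcendental L x) (F : Finset K') (hF : ∀ y ∈ F, v y ≤ 1 ∧
      ∃ p q : L[X], p.degree < N ∧ q.degree < N ∧ aeval x q ≠ 0 ∧ y * aeval x q = aeval x p) :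
    ∃ (n : ℕ) (θ : MvPolynomial (Fin n) V →ₐ[V] K') (j : List (MvPolynomial (Fin n) V)),
      IsPresentation v (AlgHom.id V K') θ j ∧ (∀ t, ∃ g : L[X], θ t = aeval x g) ∧
      ∀ y ∈ F, y ∈ fracSubring θ (valueOne v θ) := by
  classical
  have hfrac : ∀ y ∈ F, ∃ p q : L[X], p ∈ lowDegreeRing v x N ∧ q ∈ lowDegreeRing v x N ∧
      v (aeval x q) = 1 ∧ y * aeval x q = aeval x p := by
    intro y hy
    obtain ⟨hy1, p, q, hp, hq, hq0, h⟩ := hF y hy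
    obtain ⟨p', hp', q', hq', h1, h2⟩ := exists_normalized_fraction hv.exists_eq hy1 hp hq hq0 h
    exact ⟨p', q', hp', hq', h1, h2⟩
  choose! p q hp hq hq1 hpq using hfrac
  have hφ : ∃ φ : L[X], φ ≠ 0 ∧ (IsIntegral L x → φ = minpoly L x) := by
    by_cases hi : IsIntegral L x
    · exact ⟨_, minpoly.ne_zero hi, fun _ => rfl⟩
    · exact ⟨1, one_ne_zero, fun h => absurd h hi⟩
  obtain ⟨φ, hφ0, hφ⟩ := hφ
  obtain ⟨n, θ₀, T, _, _, z, ι, θ, j', j, hT, hst, hcap, b, hb, μ, M, k, hμ, hM, hk⟩ :=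
    hL.exists_stage hv hV hx hN2 hN (F.image p ∪ F.image q) (by
      intro f hf
      rcases Finset.mem_union.1 hf with hf | hf
      · obtain ⟨y, hy, rfl⟩ := Finset.mem_image.1 hf
        exact hp y hy
      · obtain ⟨y, hy, rfl⟩ := Finset.mem_image.1 hf
        exact hq y hy) hφ0
  have hpres : ∃ j, IsPresentation v (AlgHom.id V K') ((evalHom V x).comp θ) j := by
    rcases hNx with hi | htr
    · rw [hφ hi] at hM
      refine ⟨_, hst.pres.push_of_relation (a := M) ?_ (hst.regularAt hk)
        fun t ht => hst.exists_mul_eq_of_aeval_eq_zero hi hb hμ hM t ht⟩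
      rw [hM, evalHom_apply, map_mul, aeval_scaled, minpoly.aeval, mul_zero, mul_zero]
    · refine ⟨_, hst.pres.push_of_injective fun t ht => ?_⟩
      exact (transcendental_iff.1 htr) _ ht
  obtain ⟨l, hl⟩ := hpres
  obtain ⟨n, θ', l', hl', hrange, hcap'⟩ := hl.exists_mvPolynomial hT.polynomial
  refine ⟨n, θ', l', hl', fun t => ?_, fun y hy => hcap' y ?_⟩
  · obtain ⟨t', ht'⟩ := hrange t
    exact ⟨θ t', ht'.symm⟩
  · exact mem_fracSubring_of_mul_eq
      (hcap _ (Finset.mem_union_left _ (Finset.mem_image_of_mem _ hy)))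
      (hcap _ (Finset.mem_union_right _ (Finset.mem_image_of_mem _ hy))) (hq1 y hy) (hpq y hy)

end Tower

/-! ### Induction over finitely generated intermediate fields -/

section Fields

open IntermediateField

variable {V : Type u} {K K' Γ : Type*} [CommRing V] [IsDomain V] [IsLocalRing V]
  [Field K] [Algebra V K] [IsFractionRing V K] [Field K'] [Algebra K K'] [Algebra V K']
  [IsScalarTower V K K'] [LinearOrderedCommGroupWithZero Γ] {v : Valuation K' Γ}

/-- Every finite set of elements of value at most one in the intermediate field `M` is captured by a
presentation with image in `M`. -/
def IntermediateField.HasPresentations (V : Type*) {K K' Γ : Type*} [CommRing V] [IsDomain V]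
    [IsLocalRing V] [Field K] [Field K'] [Algebra K K'] [Algebra V K']
    [LinearOrderedCommGroupWithZero Γ] (v : Valuation K' Γ) (M : IntermediateField K K') : Prop :=
  ∀ F : Finset K', (∀ y ∈ F, y ∈ M ∧ v y ≤ 1) →
    ∃ (n : ℕ) (θ : MvPolynomial (Fin n) V →ₐ[V] K') (j : List (MvPolynomial (Fin n) V)),
      IsPresentation v (AlgHom.id V K') θ j ∧ (∀ t, θ t ∈ M) ∧
      ∀ y ∈ F, y ∈ fracSubring θ (valueOne v θ)

instance IntermediateField.isScalarTower_base (M : IntermediateField K K') :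
    IsScalarTower V M K' :=
  IsScalarTower.of_algebraMap_eq fun _ => rfl

omit [IsFractionRing V K] in
theorem IntermediateField.HasPresentations.restrict {M : IntermediateField K K'}
    (hM : M.HasPresentations V v) : _root_.HasPresentations V M v := by
  classical
  intro F hF
  obtain ⟨n, θ, j, h, hθ, hcap⟩ := hM (F.image (algebraMap M K')) (by
    intro y hy
    obtain ⟨y, hy', rfl⟩ := Finset.mem_image.1 hy
    exact ⟨y.2, hF y hy'⟩)
  let θ' : MvPolynomial (Fin n) V →ₐ[V] M :=
    { __ := (θ : MvPolynomial (Fin n) V →+* K').codRestrict M hθ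
      commutes' := fun c => Subtype.ext (by
        change θ (algebraMap V _ c) = algebraMap M K' (algebraMap V M c)
        rw [AlgHom.commutes, ← IsScalarTower.algebraMap_apply]) }
  have hinj : Function.Injective (algebraMap M K') := (algebraMap M K').injective
  refine ⟨n, θ', j, ⟨h.le_one, fun f hf => Subtype.ext (h.map_eq_zero f hf), h.regular,
    fun t ht => h.generic t (congrArg Subtype.val ht)⟩, fun y hy => ?_⟩
  obtain ⟨s, hs, t, ht⟩ := hcap _ (Finset.mem_image_of_mem _ hy)
  exact ⟨s, hs, t, Subtype.ext ht⟩

/-- Integral elements of `K` already lie in `V`, which is presented with no variables and no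
relations. -/
theorem IsValueExtension.hasPresentations_bot (hv : IsValueExtension V K v)
    (hV : ∀ c : V, v (algebraMap V K' c) ≤ 1) :
    (⊥ : IntermediateField K K').HasPresentations V v := by
  intro F hF
  have hpres : IsPresentation v (AlgHom.id V K') (Algebra.ofId V K') [] := by
    refine ⟨hV, by simp, trivial, fun t ht => ⟨1, Submonoid.one_mem _, ?_⟩⟩
    have : algebraMap K K' (algebraMap V K t) = 0 := by
      rw [← IsScalarTower.algebraMap_apply]; exact ht
    rw [map_eq_zero, FaithfulSMul.algebraMap_eq_zero_iff] at this
    rw [this, mul_zero]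
    exact zero_mem _
  obtain ⟨n, θ, j, h, hrange, hcap⟩ :=
    hpres.exists_mvPolynomial (isFinitePolynomialAlgebra_self V)
  refine ⟨n, θ, j, h, fun t => ?_, fun y hy => hcap y ?_⟩
  · obtain ⟨c, hc⟩ := hrange t
    rw [← hc, mem_bot]
    exact ⟨algebraMap V K c, (IsScalarTower.algebraMap_apply V K K' c).symm⟩
  · obtain ⟨hyK, hy1⟩ := hF y hy
    obtain ⟨k, rfl⟩ := mem_bot.1 hyK
    obtain ⟨c, rfl⟩ := hv.mem_range k hy1
    rw [← IsScalarTower.algebraMap_apply]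
    exact map_mem_fracSubring (Algebra.ofId V K') _ c

/-- In the algebraic case remainders modulo the minimal polynomial serve, with denominator `1` and
`N` its degree, at least two since `x ∉ L`. In the transcendental case any `N` beyond the finitely
many degrees works. -/
theorem exists_fraction_degree_lt {L : Type*} [Field L] [Algebra L K'] {x : K'}
    (hx : x ∉ (algebraMap L K').range) (F : Finset K') (hF : ∀ y ∈ F, y ∈ L⟮x⟯) :
    ∃ N : ℕ, 2 ≤ N ∧ (∀ g : L[X], g ≠ 0 → g.natDegree < N → aeval x g ≠ 0) ∧
      ∀ y ∈ F, ∃ p q : L[X], p.degree < N ∧ q.degree < N ∧ aeval x q ≠ 0 ∧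
        y * aeval x q = aeval x p := by
  classical
  by_cases hi : IsIntegral L x
  · have hN2 : 2 ≤ (minpoly L x).natDegree := (minpoly.two_le_natDegree_iff hi).2 hx
    refine ⟨(minpoly L x).natDegree, hN2, fun g hg hgN h0 => ?_, fun y hy => ?_⟩
    · exact not_lt.2 (natDegree_le_of_dvd (minpoly.dvd L x h0) hg) hgN
    · have hy' : y ∈ Algebra.adjoin L {x} := by
        rw [← adjoin_simple_toSubalgebra_of_isAlgebraic hi.isAlgebraic]
        exact hF y hy
      rw [Algebra.adjoin_singleton_eq_range_aeval] at hy'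
      obtain ⟨r, rfl⟩ := hy'
      have hmon := minpoly.monic hi
      refine ⟨r %ₘ minpoly L x, 1, ?_, ?_, by simp, ?_⟩
      · rw [← degree_eq_natDegree hmon.ne_zero]
        exact degree_modByMonic_lt r hmon
      · rw [degree_one]
        exact_mod_cast (by omega : 0 < (minpoly L x).natDegree)
      · rw [map_one, mul_one, aeval_modByMonic_eq_self_of_root (minpoly.aeval L x)]
        rfl
  · have htr : Transcendental L x := fun h => hi h.isIntegral
    choose! r s hrs using fun y hy => (mem_adjoin_simple_iff L y).1 (hF y hy)
    have hle : ∀ y ∈ F, (r y).natDegree < F.sup (fun y => (r y).natDegree + (s y).natDegree) + 2 ∧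
        (s y).natDegree < F.sup (fun y => (r y).natDegree + (s y).natDegree) + 2 := by
      intro y hy
      have := Finset.le_sup (f := fun y => (r y).natDegree + (s y).natDegree) hy
      omega
    refine ⟨_, Nat.le_add_left 2 (F.sup fun y => (r y).natDegree + (s y).natDegree),
      fun g hg _ h0 => hg (transcendental_iff.1 htr g h0), fun y hy => ?_⟩
    -- A vanishing denominator means `y = 0` by the convention for division in a field, so `0 / 1`
    -- is used instead.
    by_cases h0 : aeval x (s y) = 0
    · refine ⟨0, 1, ?_, ?_, by simp, ?_⟩
      · rw [degree_zero]; exact WithBot.bot_lt_coe _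
      · rw [degree_one]; exact_mod_cast (by omega)
      · rw [hrs y hy, h0]; simp
    · refine ⟨r y, s y, degree_le_natDegree.trans_lt ?_, degree_le_natDegree.trans_lt ?_, h0, ?_⟩
      · exact_mod_cast (hle y hy).1
      · exact_mod_cast (hle y hy).2
      · exact ((eq_div_iff h0).1 (hrs y hy))

theorem IntermediateField.HasPresentations.adjoin_simple {M : IntermediateField K K'}
    (hM : M.HasPresentations V v) (hv : IsValueExtension V K v)
    (hV : ∀ c : V, v (algebraMap V K' c) ≤ 1) (x : K') :
    (M⟮x⟯.restrictScalars K).HasPresentations V v := by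
  by_cases hxM : x ∈ M
  · have hle : ∀ y, y ∈ M⟮x⟯ ↔ y ∈ M := by
      have h := (adjoin_simple_eq_bot_iff (F := M) (α := x)).2 (mem_bot.2 ⟨(⟨x, hxM⟩ : M), rfl⟩)
      intro y
      rw [h, mem_bot]
      exact ⟨fun ⟨m, hm⟩ => hm ▸ m.2, fun hy => ⟨⟨y, hy⟩, rfl⟩⟩
    intro F hF
    obtain ⟨n, θ, j, h, hθ, hcap⟩ := hM F fun y hy => ⟨(hle y).1 (hF y hy).1, (hF y hy).2⟩
    exact ⟨n, θ, j, h, fun t => (hle _).2 (hθ t), hcap⟩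
  -- Either `x` or its inverse is integral, and both generate the same field.
  · obtain ⟨x', hx', hx'1, hx'M⟩ : ∃ x', M⟮x⟯ = M⟮x'⟯ ∧ v x' ≤ 1 ∧ x' ∉ M := by
      rcases le_total (v x) 1 with h | h
      · exact ⟨x, rfl, h, hxM⟩
      · refine ⟨x⁻¹, le_antisymm ?_ ?_, ?_, fun h => hxM (by simpa using inv_mem h)⟩
        · rw [adjoin_simple_le_iff]
          simpa using inv_mem (mem_adjoin_simple_self M x⁻¹)
        · rw [adjoin_simple_le_iff]
          exact inv_mem (mem_adjoin_simple_self M x)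
        · rw [map_inv₀]
          exact inv_le_one_of_one_le₀ h
    rw [hx']
    intro F hF
    obtain ⟨N, hN2, hN, hfrac⟩ := exists_fraction_degree_lt (L := M) (x := x')
      (fun ⟨m, hm⟩ => hx'M (hm ▸ m.2)) F fun y hy => (hF y hy).1
    have hor : IsIntegral M x' ∨ Transcendental M x' := by
      by_cases h : IsAlgebraic M x'
      exacts [.inl h.isIntegral, .inr h]
    obtain ⟨n, θ, j, h, hθ, hcap⟩ := hM.restrict.exists_presentation_of_fractions hv hV hx'1 hN2 hN
      hor F fun y hy => ⟨(hF y hy).2, hfrac y hy⟩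
    refine ⟨n, θ, j, h, fun t => ?_, hcap⟩
    obtain ⟨g, hg⟩ := hθ t
    rw [hg]
    exact (mem_adjoin_simple_iff M _).2 ⟨g, 1, by simp⟩

/-- Every finite set of elements of value at most one is captured by a presentation. -/
theorem IsValueExtension.exists_presentation (hv : IsValueExtension V K v)
    (hV : ∀ c : V, v (algebraMap V K' c) ≤ 1) (F : Finset K') (hF : ∀ y ∈ F, v y ≤ 1) :
    ∃ (n : ℕ) (θ : MvPolynomial (Fin n) V →ₐ[V] K') (j : List (MvPolynomial (Fin n) V)),
      IsPresentation v (AlgHom.id V K') θ j ∧ ∀ y ∈ F, y ∈ fracSubring θ (valueOne v θ) := by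
  obtain ⟨n, θ, j, h, -, hcap⟩ := induction_on_adjoin_finset F
    (fun M : IntermediateField K K' => M.HasPresentations V v) (hv.hasPresentations_bot hV)
    (fun M x _ hM => hM.adjoin_simple hv hV x) F
    (fun y hy => ⟨subset_adjoin K _ hy, hF y hy⟩)
  exact ⟨n, θ, j, h, hcap⟩

end Fields

/-! ### Valuation rings and the conclusion -/

section ValuationRings

variable {V V' K' : Type*} [CommRing V] [CommRing V'] [IsDomain V']
  [ValuationRing V'] [Field K'] [Algebra V' K'] [IsFractionRing V' K'] [Algebra V V']
  [Algebra V K'] [IsScalarTower V V' K']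

theorem ValuationRing.valuation_algebraMap_le_one (a : V') :
    ValuationRing.valuation V' K' (algebraMap V' K' a) ≤ 1 :=
  (ValuationRing.mem_integer_iff V' K' _).2 ⟨a, rfl⟩

theorem ValuationRing.valuation_algebraMap_eq_one_iff {a : V'} :
    ValuationRing.valuation V' K' (algebraMap V' K' a) = 1 ↔ IsUnit a := by
  constructor
  · intro h
    obtain ⟨b, hb⟩ := (ValuationRing.mem_integer_iff V' K' (algebraMap V' K' a)⁻¹).1 (by
      change ValuationRing.valuation V' K' _ ≤ 1
      rw [map_inv₀, h, inv_one])
    refine IsUnit.of_mul_eq_one b (IsFractionRing.injective V' K' ?_)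
    rw [map_mul, hb, map_one, mul_inv_cancel₀]
    intro h0
    rw [h0, map_zero] at h
    exact zero_ne_one h
  · rintro ⟨a, rfl⟩
    refine le_antisymm (valuation_algebraMap_le_one _) ?_
    have h : ValuationRing.valuation V' K' (algebraMap V' K' (a : V')) *
        ValuationRing.valuation V' K' (algebraMap V' K' (↑a⁻¹ : V')) = 1 := by
      rw [← map_mul, ← map_mul, Units.mul_inv, map_one, map_one]
    rw [← h]
    exact mul_le_of_le_one_right' (valuation_algebraMap_le_one _)

theorem MvPolynomial.exists_algHom_of_forall_le_one {n : ℕ} (θ : MvPolynomial (Fin n) V →ₐ[V] K')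
    (h : ∀ t, ValuationRing.valuation V' K' (θ t) ≤ 1) :
    ∃ ψ : MvPolynomial (Fin n) V →ₐ[V] V', ∀ t, algebraMap V' K' (ψ t) = θ t := by
  choose a ha using fun i => (ValuationRing.mem_integer_iff V' K' _).1 (h (MvPolynomial.X i))
  refine ⟨MvPolynomial.aeval a, fun t => ?_⟩
  have : (IsScalarTower.toAlgHom V V' K').comp (MvPolynomial.aeval a) = θ :=
    MvPolynomial.algHom_ext fun i => by simp [ha]
  exact DFunLike.congr_fun this t

theorem IsCompleteIntersectionAlgebra.finiteType {A B : Type*} [CommRing A] [CommRing B]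
    [Algebra A B] (h : IsCompleteIntersectionAlgebra A B) : Algebra.FiniteType A B := by
  obtain ⟨n, f, P, -, -, ⟨e⟩⟩ := h
  have h1 : Algebra.FiniteType A (Localization.Away f) :=
    (inferInstance : Algebra.FiniteType A (MvPolynomial (Fin n) A)).trans
      (have := IsLocalization.Away.finitePresentation (S := Localization.Away f) f; inferInstance)
  have h2 := h1.of_surjective (Ideal.Quotient.mkₐ A (Ideal.ofList P))
    (Ideal.Quotient.mkₐ_surjective A _)
  exact h2.equiv e.symm

end ValuationRings

section Immediate

variable {V V' K K' : Type*} [CommRing V] [IsDomain V] [ValuationRing V] [CommRing V'] [IsDomain V']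
  [ValuationRing V'] [Field K] [Algebra V K] [IsFractionRing V K] [Field K'] [Algebra V' K']
  [IsFractionRing V' K'] [Algebra V V'] [Algebra K K'] [Algebra V K'] [IsScalarTower V K K']
  [IsScalarTower V V' K']

omit [IsScalarTower V K K'] in
theorem IsImmediateExtension.isValueExtension (h : IsImmediateExtension V V' K K') :
    IsValueExtension V K (ValuationRing.valuation V' K') := by
  obtain ⟨e, he⟩ := h.valueGroup
  refine ⟨fun y _ => ?_, fun c hc => ?_, fun c hc => ?_⟩
  -- The value group of `V` is a quotient of `K`, so the preimage of the value of `y` has a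
  -- representative in `K`.
  · obtain ⟨c, hc⟩ := Quotient.exists_rep (e.symm (ValuationRing.valuation V' K' y))
    refine ⟨c, ?_⟩
    rw [← he]
    change e (Quotient.mk _ c) = _
    rw [hc, e.apply_symm_apply]
  · refine (ValuationRing.mem_integer_iff V K c).1 ?_
    change ValuationRing.valuation V K c ≤ 1
    rwa [← he, ← map_one e, map_le_map_iff e] at hc
  · intro hu
    rw [IsScalarTower.algebraMap_apply V V' K',
      ValuationRing.valuation_algebraMap_eq_one_iff.2 (hu.map _)] at hc
    exact lt_irrefl _ hc

theorem IsImmediateExtension.exists_completeIntersection (h : IsImmediateExtension V V' K K')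
    (F : Finset V') :
    ∃ C : Subalgebra V V', IsCompleteIntersectionAlgebra V C ∧ ∀ y ∈ F, y ∈ C := by
  classical
  have := h.isLocalHom
  have hV : ∀ c : V, ValuationRing.valuation V' K' (algebraMap V K' c) ≤ 1 := fun c => by
    rw [IsScalarTower.algebraMap_apply V V' K']
    exact ValuationRing.valuation_algebraMap_le_one _
  obtain ⟨n, θ, j, hpres, hcap⟩ := h.isValueExtension.exists_presentation hV
    (F.image (algebraMap V' K')) (by
      intro y hy
      obtain ⟨y, -, rfl⟩ := Finset.mem_image.1 hy
      exact ValuationRing.valuation_algebraMap_le_one _)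
  obtain ⟨ψ, hψ⟩ := MvPolynomial.exists_algHom_of_forall_le_one θ hpres.le_one
  -- An element of `V'` has value one exactly when it is a unit, so value one means lying outside
  -- the centre of the valuation.
  have hS : valueOne (ValuationRing.valuation V' K') θ =
      ((IsLocalRing.maximalIdeal V').comap ψ).primeCompl := by
    ext t
    rw [mem_valueOne, ← hψ, ValuationRing.valuation_algebraMap_eq_one_iff, Ideal.mem_primeCompl_iff,
      Ideal.mem_comap, IsLocalRing.mem_maximalIdeal, mem_nonunits_iff, not_not]
  have hinj : Function.Injective (algebraMap V V') := by
    have h1 : Function.Injective (algebraMap V K') := by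
      rw [IsScalarTower.algebraMap_eq V K K']
      exact (algebraMap K K').injective.comp (IsFractionRing.injective V K)
    rw [IsScalarTower.algebraMap_eq V V' K'] at h1
    exact Function.Injective.of_comp h1
  have hψ0 : ∀ t, ψ t = 0 ↔ θ t = 0 := fun t => by
    rw [← hψ, FaithfulSMul.algebraMap_eq_zero_iff]
  obtain ⟨s₁, hs₁, hden⟩ := exists_common_denominator _ hcap
  rw [hS] at hs₁
  obtain ⟨C, hC, hmem⟩ := exists_completeIntersection_subalgebra hinj ψ j
    (fun f hf => (hψ0 f).2 (hpres.map_eq_zero f hf)) (by rw [← hS]; exact hpres.regular)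
    (fun t ht => by
      obtain ⟨_, ⟨c, hc, s, hs, rfl⟩, hst⟩ := hpres.generic t ((hψ0 t).1 ht)
      exact ⟨c, hc, s, by rw [← hS]; exact hs, hst⟩) hs₁
  refine ⟨C, hC, fun y hy => ?_⟩
  obtain ⟨a, ha⟩ := hden _ (Finset.mem_image_of_mem _ hy)
  refine hmem a y (IsFractionRing.injective V' K' ?_)
  rw [map_mul, hψ, hψ, ha]

end Immediate

end

theorem theorem2p5 {V V' K K' : Type*}
    [CommRing V] [IsDomain V] [ValuationRing V]
    [CommRing V'] [IsDomain V'] [ValuationRing V']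
    [Field K] [Algebra V K] [IsFractionRing V K]
    [Field K'] [Algebra V' K'] [IsFractionRing V' K']
    [Algebra V V'] [Algebra K K'] [Algebra V K']
    [IsScalarTower V K K'] [IsScalarTower V V' K']
    (hV : IsImmediateExtension V V' K K') :
    IsFilteredUnionOfSubalgebras V V' (fun C => IsCompleteIntersectionAlgebra V C) := by
  classical
  -- The family of all complete intersection subalgebras works: an upper bound of two of them is one
  -- that contains finite generating sets of both.
  refine ⟨{C | IsCompleteIntersectionAlgebra V C}, ?_, ?_, fun C hC => hC, fun b => ?_⟩
  · obtain ⟨C, hC, -⟩ := hV.exists_completeIntersection ∅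
    exact ⟨C, hC⟩
  · intro C₁ h₁ C₂ h₂
    obtain ⟨F₁, rfl⟩ := C₁.fg_iff_finiteType.2 h₁.finiteType
    obtain ⟨F₂, rfl⟩ := C₂.fg_iff_finiteType.2 h₂.finiteType
    obtain ⟨C, hC, hF⟩ := hV.exists_completeIntersection (F₁ ∪ F₂)
    exact ⟨C, hC, Algebra.adjoin_le fun y hy => hF y (Finset.mem_union_left _ hy),
      Algebra.adjoin_le fun y hy => hF y (Finset.mem_union_right _ hy)⟩
  · obtain ⟨C, hC, hF⟩ := hV.exists_completeIntersection {b}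
    exact ⟨C, hC, hF b (Finset.mem_singleton_self b)⟩
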